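/- **Theorem 4.1.** Let $(Z_t)_{t\in\mathbb Z}$ be i.i.d. real random variables with $\mathbb E Z_0=0$, $\mathbb E Z_0^2=1$, and let $\mathcal F_t=\sigma(Z_k;k\le t)$. Let $p,q\ge 0$ be integers, $\Theta\subset\mathbb R^d$, and let $\{g_\theta:\theta\in\Theta\}$ be functions $\mathbb R^p\times[0,\infty)^q\to[0,\infty)$. Consider the model $$X_t=\sigma_tZ_t,\qquad \sigma_t^2=g_\theta(X_{t-1},\dots,X_{t-p};\sigma_{t-1}^2,\dots,\sigma_{t-q}^2)\quad\text{a.s.},\qquad t\in\mathbb Z,$$ where $\sigma_t\ge 0$ is $\mathcal F_{t-1}$-measurable. Let $K\subset\Theta$ be compact, $\theta_0\in K$, let $\mathbb C(K,[0,\infty)^q)$ carry the metric of $\|s\|_K=\sup_{\theta\in K}|s(\theta)|$ ($|\cdot|$ Euclidean) and its Borel $\sigma$-field, and suppose that $x\mapsto g_\theta(x,s)$ is measurable for all $\theta\in K$ and $s$. For a map $\phi$ of a metric space into itself put $\Lambda(\phi)=\sup_{x\ne y}d(\phi(x),\phi(y))/d(x,y)$. Assume: 1. The model with $\theta=\theta_0$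 has an (a.s.) unique stationary ergodic solution $((X_t,\sigma_t^2))_{t\in\mathbb Z}$, and $\mathbb E\log^+\sigma_0^2<\infty$. 2. The map $(\theta,s)\mapsto g_\theta(x,s)$ is continuous on $K\times[0,\infty)^q$ for every $x\in\mathbb R^p$. With $\mathbf X_t=(X_t,\dots,X_{t-p+1})$, let the random maps $\Phi_t:\mathbb C(K,[0,\infty)^q)\to\mathbb C(K,[0,\infty)^q)$ be given by $$[\Phi_t(s)](\theta)=\bigl(g_\theta(\mathbf X_t,s(\theta)),s_1(\theta),\dots,s_{q-1}(\theta)\bigr).$$ For a fixed initial value $\varsigma\in[0,\infty)^q$ (regarded as a constant function on $K$) one has $\mathbb E\log^+\|\Phi_0(\varsigma)\|_K<\infty$; moreover $\mathbb E\log^+\Lambda(\Phi_0)<\infty$, and there is an integer $r\ge1$ with $\mathbb E\log\Lambda(\Phi_0\circ\Phi_{-1}\circ\dots\circ\Phi_{-r+1})<0$ (the value $-\infty$ being allowed). 3. There is $\underline g>0$ with $g_\theta(x,s)\ge\underline g$ for all $\theta\in K$, $(x,s)\in\mathbb R^p\times[0,\infty)^q$. 4. Let $(\mathbf h_t)_{t\in\mathbb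 Z}$ be the stationary solution in $\mathbb C(K,[0,\infty)^q)$ of $\mathbf h_{t+1}=\Phi_t(\mathbf h_t)$ a.s., $t\in\mathbb Z$, and let $h_t(\theta)=g_\theta(\mathbf X_{t-1},\mathbf h_{t-1}(\theta))$, which for $q\ge1$ is a.s. the first coordinate of $\mathbf h_t(\theta)$. Then for all $\theta\in K$: $h_0(\theta)=\sigma_0^2$ a.s. if and only if $\theta=\theta_0$. Define $\hat{\mathbf h}_0=\varsigma$, $\hat{\mathbf h}_{t+1}=\Phi_t(\hat{\mathbf h}_t)$ for $t\ge0$, and $\hat h_t(\theta)=g_\theta(\mathbf X_{t-1},\hat{\mathbf h}_{t-1}(\theta))$ for $t\ge1$ (for $q\ge1$ the first coordinate of $\hat{\mathbf h}_t(\theta)$), and $$\hat L_n(\theta)=-\frac12\sum_{t=1}^n\left(\frac{X_t^2}{\hat h_t(\theta)}+\log\hat h_t(\theta)\right),\qquad\theta\in K.$$ Let $\hat\theta_n\in K$, $n\ge1$, be such that $\hat\theta_n$ maximizes $\hat L_n$ over $K$ almost surely (the Gaussian quasi maximum likelihood estimator). Then $\hat\theta_n\to\theta_0$ almost surely as $n\to\infty$.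 -/

import Mathlib

open MeasureTheory ProbabilityTheory Filter Topology TopologicalSpace
open scoped NNReal ENNReal

/-! ### Random sequences -/

/-- The left shift on two-sided sequences. -/
def seqShift {E : Type*} (v : ℤ → E) : ℤ → E := fun t => v (t + 1)

/-- The law of a two-sided random sequence, a measure on the product space `E^ℤ`. -/
noncomputable def seqLaw {Ω E : Type*} [MeasurableSpace Ω] [MeasurableSpace E]
    (μ : Measure Ω) (v : ℤ → Ω → E) : Measure (ℤ → E) :=
  μ.map fun ω t => v t ω

/-- `v` is a (strictly) stationary sequence of random elements: the shift preserves its law. -/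
def IsStationarySeq {Ω E : Type*} [MeasurableSpace Ω] [MeasurableSpace E]
    (μ : Measure Ω) (v : ℤ → Ω → E) : Prop :=
  (∀ t, Measurable (v t)) ∧ MeasurePreserving seqShift (seqLaw μ v) (seqLaw μ v)

/-- `v` is a stationary ergodic sequence of random elements: the shift preserves its law and is
ergodic for it. -/
def IsStationaryErgodicSeq {Ω E : Type*} [MeasurableSpace Ω] [MeasurableSpace E]
    (μ : Measure Ω) (v : ℤ → Ω → E) : Prop :=
  (∀ t, Measurable (v t)) ∧ Ergodic seqShift (seqLaw μ v)

/-- An i.i.d. sequence of real random variables with mean zero and unit second moment. -/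
structure IsIIDNoise {Ω : Type*} [MeasurableSpace Ω] (μ : Measure Ω) (Z : ℤ → Ω → ℝ) : Prop where
  measurable : ∀ t, Measurable (Z t)
  indep : iIndepFun Z μ
  identDistrib : ∀ t, IdentDistrib (Z t) (Z 0) μ μ
  mean : ∫ ω, Z 0 ω ∂μ = 0
  second_moment : ∫ ω, Z 0 ω ^ 2 ∂μ = 1

/-- The σ-field generated by the random variables `Z k`, `k ≤ t`. -/
@[reducible] def pastField {Ω : Type*} (Z : ℤ → Ω → ℝ) (t : ℤ) : MeasurableSpace Ω :=
  ⨆ k, ⨆ (_ : k ≤ t), MeasurableSpace.comap (Z k) inferInstance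

/-! ### Logarithmic moments and Lipschitz coefficients -/

/-- `E[log⁺ Y]` for a `[0, ∞]`-valued `Y` (with `log 0 = -∞`). -/
noncomputable def meanLogPos {Ω : Type*} [MeasurableSpace Ω] (μ : Measure Ω) (Y : Ω → ℝ≥0∞) :
    ℝ≥0∞ :=
  ∫⁻ ω, (ENNReal.log (Y ω)).toENNReal ∂μ

/-- `E[log⁻ Y]` for a `[0, ∞]`-valued `Y` (with `log 0 = -∞`). -/
noncomputable def meanLogNeg {Ω : Type*} [MeasurableSpace Ω] (μ : Measure Ω) (Y : Ω → ℝ≥0∞) :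
    ℝ≥0∞ :=
  ∫⁻ ω, (-ENNReal.log (Y ω)).toENNReal ∂μ

/-- `E[log Y] < 0`, where `E[log Y] = E[log⁺ Y] - E[log⁻ Y]` is well defined in `[-∞, ∞)` and may
equal `-∞`. (The strict inequality forces `E[log⁺ Y] < ∞`.) -/
def MeanLogNegative {Ω : Type*} [MeasurableSpace Ω] (μ : Measure Ω) (Y : Ω → ℝ≥0∞) : Prop :=
  meanLogPos μ Y < meanLogNeg μ Y

/-- The Lipschitz coefficient `sup_{x ≠ y} d(φ x, φ y) / d(x, y)`; it is finite exactly for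
Lipschitz maps. -/
noncomputable def lipCoeff {E : Type*} [MetricSpace E] (φ : E → E) : ℝ≥0∞ :=
  ⨆ (x : E) (y : E) (_ : x ≠ y), edist (φ x) (φ y) / edist x y

/-- The `r`-fold iterate of past and present maps, `φ_t ∘ φ_{t-1} ∘ ⋯ ∘ φ_{t-r+1}`. -/
def pastIterate {E : Type*} (φ : ℤ → E → E) : ℤ → ℕ → E → E
  | _, 0 => id
  | t, r + 1 => φ t ∘ pastIterate φ (t - 1) r

/-! ### The model -/

/-- The space `[0, ∞)^q` with the Euclidean metric. -/
abbrev VolState (q : ℕ) : Type := PiLp 2 fun _ : Fin q => ℝ≥0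

/-- The vector `(X_t, X_{t-1}, …, X_{t-p+1})`. -/
def obsVec {Ω : Type*} (p : ℕ) (X : ℤ → Ω → ℝ) (t : ℤ) (ω : Ω) : Fin p → ℝ :=
  fun i => X (t - (i : ℕ)) ω

/-- The vector `(σ_t², σ_{t-1}², …, σ_{t-q+1}²)`. -/
noncomputable def volVec {Ω : Type*} (q : ℕ) (σ : ℤ → Ω → ℝ≥0) (t : ℤ) (ω : Ω) : VolState q :=
  WithLp.toLp 2 fun i => σ (t - (i : ℕ)) ω ^ 2

/-- `(X, σ)` solves `X_t = σ_t Z_t`, `σ_t² = γ(X_{t-1}, …, X_{t-p}; σ_{t-1}², …, σ_{t-q}²)` almost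
surely for all `t ∈ ℤ`, where `σ_t ≥ 0` is measurable with respect to the σ-field generated by
`Z_k`, `k ≤ t - 1`. -/
structure IsModelSolution {Ω : Type*} [MeasurableSpace Ω] (μ : Measure Ω) {p q : ℕ}
    (Z : ℤ → Ω → ℝ) (γ : (Fin p → ℝ) → VolState q → ℝ≥0)
    (X : ℤ → Ω → ℝ) (σ : ℤ → Ω → ℝ≥0) : Prop where
  measurable_obs : ∀ t, Measurable (X t)
  measurable_vol : ∀ t, Measurable[pastField Z (t - 1)] (σ t)
  obs_eq : ∀ t, ∀ᵐ ω ∂μ, X t ω = σ t ω * Z t ω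
  vol_eq : ∀ t, ∀ᵐ ω ∂μ, σ t ω ^ 2 = γ (obsVec p X (t - 1) ω) (volVec q σ (t - 1) ω)

/-- A solution of the model for which `((X_t, σ_t²))` is stationary and ergodic. -/
def IsStationaryErgodicSolution {Ω : Type*} [MeasurableSpace Ω] (μ : Measure Ω) {p q : ℕ}
    (Z : ℤ → Ω → ℝ) (γ : (Fin p → ℝ) → VolState q → ℝ≥0)
    (X : ℤ → Ω → ℝ) (σ : ℤ → Ω → ℝ≥0) : Prop :=
  IsModelSolution μ Z γ X σ ∧ IsStationaryErgodicSeq μ fun t ω => (X t ω, σ t ω ^ 2)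

/-- `(X, σ)` is, up to almost sure equality, the only stationary ergodic solution. -/
def IsUniqueStationaryErgodicSolution {Ω : Type*} [MeasurableSpace Ω] (μ : Measure Ω) {p q : ℕ}
    (Z : ℤ → Ω → ℝ) (γ : (Fin p → ℝ) → VolState q → ℝ≥0)
    (X : ℤ → Ω → ℝ) (σ : ℤ → Ω → ℝ≥0) : Prop :=
  IsStationaryErgodicSolution μ Z γ X σ ∧
    ∀ (X' : ℤ → Ω → ℝ) (σ' : ℤ → Ω → ℝ≥0), IsStationaryErgodicSolution μ Z γ X' σ' →
      ∀ t, ∀ᵐ ω ∂μ, X' t ω = X t ω ∧ σ' t ω = σ t ω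

/-! ### The stochastic recurrence equation on `C(K, [0, ∞)^q)` -/

/-- Spaces of continuous maps carry their Borel σ-field. -/
instance contMapMeasurableSpace {α β : Type*} [TopologicalSpace α] [TopologicalSpace β] :
    MeasurableSpace C(α, β) :=
  borel _

/-- The vector `(v, s_1, …, s_{q-1})`. -/
noncomputable def pushState {q : ℕ} (v : ℝ≥0) (s : VolState q) : VolState q :=
  WithLp.toLp 2 fun i => if (i : ℕ) = 0 then v else s ⟨i - 1, by omega⟩

theorem continuous_pushState {q : ℕ} :
    Continuous fun a : ℝ≥0 × VolState q => pushState a.1 a.2 := by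
  refine (PiLp.continuous_toLp 2 _).comp (continuous_pi fun i => ?_)
  by_cases h : (i : ℕ) = 0
  · simpa [h] using continuous_fst
  · simp only [h, if_false]
    exact (PiLp.continuous_apply 2 _ _).comp continuous_snd

section SRE

variable {d p q : ℕ} {Θ : Set (EuclideanSpace ℝ (Fin d))}

/-- The map `[Φ(s)](θ) = (g_θ(x, s(θ)), s_1(θ), …, s_{q-1}(θ))`, `θ ∈ K`, on `C(K, [0, ∞)^q)`
(equipped with the supremum distance). -/
noncomputable def volMap (g : Θ → (Fin p → ℝ) → VolState q → ℝ≥0) (K : Compacts Θ)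
    (hg : ∀ x, Continuous fun a : K × VolState q => g a.1 x a.2) (x : Fin p → ℝ)
    (s : C(K, VolState q)) : C(K, VolState q) where
  toFun θ := pushState (g θ x (s θ)) (s θ)
  continuous_toFun :=
    continuous_pushState.comp
      (((hg x).comp (continuous_id.prodMk s.continuous)).prodMk s.continuous)

/-- The random maps `Φ_t`, i.e. `volMap` at `x = (X_t, …, X_{t-p+1})`. -/
noncomputable def sreMap {Ω : Type*} (g : Θ → (Fin p → ℝ) → VolState q → ℝ≥0) (K : Compacts Θ)
    (hg : ∀ x, Continuous fun a : K × VolState q => g a.1 x a.2) (X : ℤ → Ω → ℝ)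
    (t : ℤ) (ω : Ω) : C(K, VolState q) → C(K, VolState q) :=
  volMap g K hg (obsVec p X t ω)

/-- `(h_t)_{t ∈ ℤ}` is a stationary sequence of random elements of `C(K, [0, ∞)^q)` that solves
`h_{t+1} = Φ_t(h_t)` almost surely for all `t ∈ ℤ`. -/
def IsStationarySRESolution {Ω : Type*} [MeasurableSpace Ω] (μ : Measure Ω)
    (g : Θ → (Fin p → ℝ) → VolState q → ℝ≥0) (K : Compacts Θ)
    (hg : ∀ x, Continuous fun a : K × VolState q => g a.1 x a.2) (X : ℤ → Ω → ℝ)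
    (h : ℤ → Ω → C(K, VolState q)) : Prop :=
  IsStationarySeq μ h ∧ ∀ t, ∀ᵐ ω ∂μ, h (t + 1) ω = sreMap g K hg X t ω (h t ω)

/-- The recursion started at the constant function `ς`: `ĥ_0 = ς`, `ĥ_{t+1} = Φ_t(ĥ_t)`, for the
vector functions `(ĥ_t, …, ĥ_{t-q+1})`. -/
noncomputable def volHat {Ω : Type*} (g : Θ → (Fin p → ℝ) → VolState q → ℝ≥0) (K : Compacts Θ)
    (hg : ∀ x, Continuous fun a : K × VolState q => g a.1 x a.2) (X : ℤ → Ω → ℝ)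
    (ς : VolState q) : ℕ → Ω → C(K, VolState q)
  | 0, _ => ContinuousMap.const K ς
  | t + 1, ω => sreMap g K hg X t ω (volHat g K hg X ς t ω)

/-- If `s : C(K, [0, ∞)^q)` is the vector of volatility functions at time `t`, this is the scalar
squared volatility function at time `t + 1`, namely `θ ↦ g_θ(X_t, …, X_{t-p+1}; s(θ))`. For
`q ≥ 1` it is the first coordinate of `Φ_t(s)`; in this form it also makes sense for `q = 0`. -/
def nextVol {Ω : Type*} (g : Θ → (Fin p → ℝ) → VolState q → ℝ≥0) (K : Compacts Θ)
    (X : ℤ → Ω → ℝ) (t : ℤ) (ω : Ω) (s : C(K, VolState q)) (θ : K) : ℝ≥0 :=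
  g θ (obsVec p X t ω) (s θ)

theorem nextVol_eq_first_coord {Ω : Type*} (g : Θ → (Fin p → ℝ) → VolState q → ℝ≥0)
    (K : Compacts Θ) (hg : ∀ x, Continuous fun a : K × VolState q => g a.1 x a.2)
    (X : ℤ → Ω → ℝ) (t : ℤ) (ω : Ω) (s : C(K, VolState q)) (θ : K) (hq : 0 < q) :
    nextVol g K X t ω s θ = sreMap g K hg X t ω s θ ⟨0, hq⟩ := by
  simp [nextVol, sreMap, volMap, pushState]

/-- The Gaussian quasi log-likelihood
`L̂_n(θ) = -(1/2) ∑_{t=1}^n (X_t² / ĥ_t(θ) + log ĥ_t(θ))`, `θ ∈ K`; the sum is indexed by `t - 1`,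
and `ĥ_{t+1}(θ) = g_θ(X_t, …, X_{t-p+1}; ĥ_t(θ), …, ĥ_{t-q+1}(θ))`. -/
noncomputable def quasiLogLik {Ω : Type*} (g : Θ → (Fin p → ℝ) → VolState q → ℝ≥0)
    (K : Compacts Θ) (hg : ∀ x, Continuous fun a : K × VolState q => g a.1 x a.2)
    (X : ℤ → Ω → ℝ) (ς : VolState q) (n : ℕ) (ω : Ω) (θ : K) : ℝ :=
  -(1 / 2) * ∑ t ∈ Finset.range n,
    (X ((t : ℤ) + 1) ω ^ 2 / (nextVol g K X t ω (volHat g K hg X ς t ω) θ : ℝ)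
      + Real.log (nextVol g K X t ω (volHat g K hg X ς t ω) θ : ℝ))

/-- `θ̂_n`, `n ≥ 1`, is a quasi maximum likelihood estimator: a `K`-valued maximizer of `L̂_n`
over `K`, almost surely. -/
def IsQMLE {Ω : Type*} [MeasurableSpace Ω] (μ : Measure Ω)
    (g : Θ → (Fin p → ℝ) → VolState q → ℝ≥0)
    (K : Compacts Θ) (hg : ∀ x, Continuous fun a : K × VolState q => g a.1 x a.2)
    (X : ℤ → Ω → ℝ) (ς : VolState q) (θhat : ℕ → Ω → K) : Prop :=
  ∀ n, 1 ≤ n → ∀ᵐ ω ∂μ, ∀ θ : K,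
    quasiLogLik g K hg X ς n ω θ ≤ quasiLogLik g K hg X ς n ω (θhat n ω)

end SRE

/-!
Averaged over time, the random maps `Φ_t` contract, so the backward iterates
`Φ_{t-1} ∘ ⋯ ∘ Φ_{t-n}(ς)` converge to a stationary solution `h_t`, and the recursion started at `ς`
forgets its initial value exponentially fast. As `log (1 + X_t²)` is integrable, `X_t²` grows
subexponentially, and `-2 L̂_n(θ)` differs from the ergodic sum of `X_t² / h_t(θ) + log h_t(θ)` by a
bounded amount, uniformly in `θ`.

Given the past, `X_t²` has mean `σ_t²`, so the expectation of a summand is that of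
`σ_0² / h_0(θ) + log h_0(θ)`. By `log x ≤ x - 1` this is smallest exactly when `h_0(θ) = σ_0²`
almost surely, i.e. for `θ = θ₀`. The expectation may be infinite for `θ ≠ θ₀`; but the summands are
bounded below, so each `θ ≠ θ₀` has a neighbourhood on which an integrable minorant still has a
larger expectation, and the ergodic theorem and compactness eventually force the minimizers of the
sums into any ball around `θ₀`.
-/

/-! ### The pointwise ergodic theorem -/

section Birkhoff

variable {S : Type*} {τ : S → S} {f : S → ℝ}

/-- The running maximum `max (0, S_1 f, …, S_n f)` of the Birkhoff sums, in the recursive form on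
which the maximal ergodic inequality rests. -/
noncomputable def birkhoffMax (τ : S → S) (f : S → ℝ) : ℕ → S → ℝ
  | 0, _ => 0
  | n + 1, x => max 0 (f x + birkhoffMax τ f n (τ x))

theorem birkhoffMax_nonneg (n : ℕ) (x : S) : 0 ≤ birkhoffMax τ f n x := by
  cases n with
  | zero => exact le_rfl
  | succ n => exact le_max_left _ _

theorem birkhoffSum_le_birkhoffMax (n : ℕ) (x : S) : birkhoffSum τ f n x ≤ birkhoffMax τ f n x := by
  induction n generalizing x with
  | zero => simp [birkhoffMax]
  | succ n ih =>
    rw [birkhoffSum_succ']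
    exact (add_le_add_right (ih (τ x)) _).trans (le_max_right _ _)

theorem monotone_birkhoffMax (x : S) : Monotone fun n => birkhoffMax τ f n x := by
  refine monotone_nat_of_le_succ fun n => ?_
  induction n generalizing x with
  | zero => exact le_max_left _ _
  | succ n ih => exact max_le_max le_rfl (add_le_add_right (ih (τ x)) _)

theorem abs_birkhoffMax_succ_sub_le (n : ℕ) (x : S) :
    |birkhoffMax τ f (n + 1) x - birkhoffMax τ f n (τ x)| ≤ |f x| := by
  simpa [birkhoffMax, max_comm, birkhoffMax_nonneg] using
    abs_max_sub_max_le_abs (f x + birkhoffMax τ f n (τ x)) (birkhoffMax τ f n (τ x)) 0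

theorem bddAbove_birkhoffMax_comp (x : S) :
    BddAbove (Set.range fun n => birkhoffMax τ f n (τ x)) ↔
      BddAbove (Set.range fun n => birkhoffMax τ f n x) := by
  constructor
  · rintro ⟨C, hC⟩
    refine ⟨max 0 (f x + C), Set.forall_mem_range.2 fun n => ?_⟩
    exact (monotone_birkhoffMax x n.le_succ).trans
      (max_le_max le_rfl (add_le_add_right (hC ⟨n, rfl⟩) _))
  · rintro ⟨C, hC⟩
    refine ⟨C - f x, Set.forall_mem_range.2 fun n => le_sub_iff_add_le'.2 ?_⟩
    exact (le_max_right _ _).trans (hC ⟨n + 1, rfl⟩)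

theorem tendsto_birkhoffMax_succ_sub {x : S}
    (hx : ¬ BddAbove (Set.range fun n => birkhoffMax τ f n x)) :
    Tendsto (fun n => birkhoffMax τ f (n + 1) x - birkhoffMax τ f n (τ x)) atTop (𝓝 (f x)) := by
  have hlim : Tendsto (fun n => birkhoffMax τ f n (τ x)) atTop atTop :=
    tendsto_atTop_atTop_of_monotone' (monotone_birkhoffMax (τ x))
      (mt (bddAbove_birkhoffMax_comp x).1 hx)
  refine tendsto_const_nhds.congr' ?_
  filter_upwards [hlim.eventually_ge_atTop (-f x)] with n hn
  rw [birkhoffMax, max_eq_right (by linarith), add_sub_cancel_right]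

variable [MeasurableSpace S] {P : Measure S}

theorem measurable_birkhoffMax (hτ : Measurable τ) (hf : Measurable f) (n : ℕ) :
    Measurable (birkhoffMax τ f n) := by
  induction n with
  | zero => exact measurable_const
  | succ n ih => exact measurable_const.max (hf.add (ih.comp hτ))

theorem integrable_birkhoffMax (hτ : MeasurePreserving τ P P) (hf : Integrable f P) (n : ℕ) :
    Integrable (birkhoffMax τ f n) P := by
  induction n with
  | zero => exact integrable_zero _ _ _
  | succ n ih => exact (integrable_zero _ _ _).sup (hf.add (hτ.integrable_comp_of_integrable ih))

theorem integral_birkhoffMax_succ_sub_nonneg (hτ : MeasurePreserving τ P P)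
    (hf : Integrable f P) (n : ℕ) :
    0 ≤ ∫ x, (birkhoffMax τ f (n + 1) x - birkhoffMax τ f n (τ x)) ∂P := by
  have hint := integrable_birkhoffMax hτ hf
  have hinv : ∫ x, birkhoffMax τ f n (τ x) ∂P = ∫ x, birkhoffMax τ f n x ∂P := by
    rw [← integral_map hτ.aemeasurable (by rw [hτ.map_eq]; exact (hint n).1), hτ.map_eq]
  have hcomp : Integrable (fun x => birkhoffMax τ f n (τ x)) P :=
    hτ.integrable_comp_of_integrable (hint n)
  rw [integral_sub (hint _) hcomp, hinv, sub_nonneg]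
  exact integral_mono (hint _) (hint _) fun x => monotone_birkhoffMax x n.le_succ

theorem ae_bddAbove_birkhoffSum (hτ : Ergodic τ P) (hm : Measurable f)
    (hf : Integrable f P) (hneg : ∫ x, f x ∂P < 0) :
    ∀ᵐ x ∂P, BddAbove (Set.range fun n => birkhoffSum τ f n x) := by
  have hmeas : MeasurableSet {x | BddAbove (Set.range fun n => birkhoffMax τ f n x)} :=
    measurableSet_bddAbove_range fun n => measurable_birkhoffMax hτ.measurable hm n
  rcases hτ.toPreErgodic.ae_mem_or_ae_notMem hmeas (Set.ext bddAbove_birkhoffMax_comp)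
    with hbdd | hunbdd
  · filter_upwards [hbdd] with x hx
    exact hx.range_mono _ fun n => birkhoffSum_le_birkhoffMax n x
  · have hint := integrable_birkhoffMax hτ.toMeasurePreserving hf
    have hlim : Tendsto (fun n => ∫ x, (birkhoffMax τ f (n + 1) x - birkhoffMax τ f n (τ x)) ∂P)
        atTop (𝓝 (∫ x, f x ∂P)) :=
      tendsto_integral_of_dominated_convergence (fun x => |f x|)
        (fun n => ((hint _).sub
          (hτ.toMeasurePreserving.integrable_comp_of_integrable (hint n))).aestronglyMeasurable)
        hf.abs (fun n => ae_of_all _ (abs_birkhoffMax_succ_sub_le n))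
        (hunbdd.mono fun x hx => tendsto_birkhoffMax_succ_sub hx)
    exact absurd (ge_of_tendsto' hlim
      (integral_birkhoffMax_succ_sub_nonneg hτ.toMeasurePreserving hf)) hneg.not_ge

variable [IsProbabilityMeasure P]

theorem ae_eventually_birkhoffAverage_lt (hτ : Ergodic τ P) (hm : Measurable f)
    (hf : Integrable f P) :
    ∀ᵐ x ∂P, ∀ a > ∫ y, f y ∂P, ∀ᶠ n in atTop, birkhoffAverage ℝ τ f n x < a := by
  have hbdd : ∀ b : ℚ, ∫ y, f y ∂P < b →
      ∀ᵐ x ∂P, BddAbove (Set.range fun n => birkhoffSum τ (fun y => f y - b) n x) := fun b hb =>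
    ae_bddAbove_birkhoffSum hτ (hm.sub_const _) (hf.sub (integrable_const _)) (by
      rw [integral_sub hf (integrable_const _)]
      simpa using hb)
  filter_upwards [ae_all_iff.2 fun b => eventually_imp_distrib_left.2 (hbdd b)] with x hx a ha
  obtain ⟨b, hb, hba⟩ := exists_rat_btwn ha
  obtain ⟨C, hC⟩ := hx b hb
  have hlim : Tendsto (fun n : ℕ => C / (n : ℝ) + b) atTop (𝓝 (0 + b)) :=
    (tendsto_const_div_atTop_nhds_zero_nat C).add_const _
  filter_upwards [hlim.eventually_lt_const (by rwa [zero_add]), eventually_gt_atTop 0]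
    with n hn hn0
  have hn0' : (0 : ℝ) < n := Nat.cast_pos.2 hn0
  have hsum : birkhoffSum τ f n x - n * b ≤ C := by
    simpa [birkhoffSum, Finset.sum_sub_distrib] using hC ⟨n, rfl⟩
  refine lt_of_le_of_lt ?_ hn
  rw [birkhoffAverage, smul_eq_mul, ← div_eq_inv_mul, div_le_iff₀ hn0', add_mul,
    div_mul_cancel₀ _ hn0'.ne']
  linarith

theorem ae_birkhoffSum_le_neg_mul (hτ : Ergodic τ P) (hm : Measurable f) (hf : Integrable f P)
    (hneg : ∫ x, f x ∂P < 0) :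
    ∀ᵐ x ∂P, ∃ δ > 0, ∀ᶠ n : ℕ in atTop, birkhoffSum τ f n x ≤ -δ * n := by
  filter_upwards [ae_eventually_birkhoffAverage_lt hτ hm hf] with x hx
  refine ⟨-(∫ y, f y ∂P) / 2, by linarith, ?_⟩
  filter_upwards [hx ((∫ y, f y ∂P) / 2) (by linarith), eventually_gt_atTop 0] with n hn hn0
  rw [birkhoffAverage, smul_eq_mul, inv_mul_lt_iff₀ (Nat.cast_pos.2 hn0)] at hn
  linarith

theorem ae_tendsto_birkhoffAverage (hτ : Ergodic τ P) (hm : Measurable f) (hf : Integrable f P) :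
    ∀ᵐ x ∂P, Tendsto (fun n => birkhoffAverage ℝ τ f n x) atTop (𝓝 (∫ y, f y ∂P)) := by
  filter_upwards [ae_eventually_birkhoffAverage_lt hτ hm hf,
    ae_eventually_birkhoffAverage_lt hτ hm.neg hf.neg] with x hlt hgt
  refine tendsto_order.2 ⟨fun a ha => ?_, hlt⟩
  filter_upwards [hgt (-a) (by simpa only [Pi.neg_apply, integral_neg, gt_iff_lt, neg_lt_neg_iff])]
    with n hn
  simpa only [birkhoffAverage_neg, Pi.neg_apply, neg_lt_neg_iff] using hn

theorem ae_isLittleO_comp_iterate (hτ : Ergodic τ P) (hm : Measurable f) (hf : Integrable f P) :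
    ∀ᵐ x ∂P, (fun n => f (τ^[n] x)) =o[atTop] fun n : ℕ => (n : ℝ) := by
  have hlim := ae_tendsto_birkhoffAverage hτ hm hf
  filter_upwards [hlim, hτ.quasiMeasurePreserving.ae hlim] with x hx hτx
  have hdiff : Tendsto (fun n : ℕ => (n : ℝ)⁻¹ • (f (τ^[n] x) - f x)) atTop (𝓝 0) := by
    simpa only [birkhoffAverage_apply_sub_birkhoffAverage, sub_self] using hτx.sub hx
  refine Asymptotics.isLittleO_of_tendsto' (by
    filter_upwards [eventually_ne_atTop 0] with n hn h
    exact absurd (Nat.cast_eq_zero.1 h) hn) ?_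
  simpa [div_eq_inv_mul, mul_sub] using
    hdiff.add ((tendsto_inv_atTop_nhds_zero_nat (𝕜 := ℝ)).mul_const (f x))

end Birkhoff

/-! ### Geometric decay -/

section Decay

theorem prod_range_add_le {M : Type*} [CommMonoid M] [PartialOrder M] [IsOrderedMonoid M]
    {a c : ℕ → M} {r : ℕ} (hr : 1 ≤ r) (h : ∀ n, a (n + r) ≤ a n * c n) (n : ℕ) :
    ∏ i ∈ Finset.range r, a (n + i) ≤ (∏ i ∈ Finset.range r, a i) * ∏ k ∈ Finset.range n, c k := by
  obtain ⟨s, rfl⟩ := Nat.exists_eq_add_of_le' hr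
  induction n with
  | zero => simp
  | succ n ih =>
    calc ∏ i ∈ Finset.range (s + 1), a (n + 1 + i)
        = (∏ i ∈ Finset.range s, a (n + (i + 1))) * a (n + (s + 1)) := by
          rw [Finset.prod_range_succ]
          simp only [add_assoc, add_comm 1]
      _ ≤ (∏ i ∈ Finset.range s, a (n + (i + 1))) * (a n * c n) := mul_le_mul_right (h n) _
      _ = (∏ i ∈ Finset.range (s + 1), a (n + i)) * c n := by
          rw [Finset.prod_range_succ', add_zero, mul_assoc]
      _ ≤ _ := by
          rw [Finset.prod_range_succ _ n, ← mul_assoc]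
          exact mul_le_mul_left ih _

theorem le_mul_prod_range {M : Type*} [CommMonoid M] [PartialOrder M] [IsOrderedMonoid M]
    {a c : ℕ → M} (hc : ∀ n, 1 ≤ c n) (h : ∀ n, a (n + 1) ≤ a n * c n) (n : ℕ) {i r : ℕ}
    (hir : i ≤ r) : a (n + r) ≤ a (n + i) * ∏ j ∈ Finset.range r, c (n + j) := by
  induction r, hir using Nat.le_induction with
  | base => exact le_mul_of_one_le_right' (Finset.one_le_prod' fun j _ => hc _)
  | succ r _ ih =>
    rw [Finset.prod_range_succ, ← mul_assoc]
    exact (h (n + r)).trans (mul_le_mul_left ih _)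

theorem ofReal_exp_sum {ι : Type*} (s : Finset ι) (f : ι → ℝ) :
    ENNReal.ofReal (Real.exp (∑ i ∈ s, f i)) = ∏ i ∈ s, ENNReal.ofReal (Real.exp (f i)) := by
  rw [Real.exp_sum, ENNReal.ofReal_prod_of_nonneg fun _ _ => Real.exp_nonneg _]

theorem isLittleO_const_natCast (C : ℝ) :
    (fun _ : ℕ => C) =o[atTop] fun n : ℕ => (n : ℝ) :=
  Asymptotics.isLittleO_const_left.2
    (.inr (tendsto_norm_atTop_atTop.comp tendsto_natCast_atTop_atTop))

theorem isLittleO_comp_add_natCast {b : ℕ → ℝ} (hb : b =o[atTop] fun n : ℕ => (n : ℝ)) (k : ℕ) :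
    (fun n => b (n + k)) =o[atTop] fun n : ℕ => (n : ℝ) := by
  refine (hb.comp_tendsto (tendsto_add_atTop_nat k)).trans_isBigO ?_
  simpa [Function.comp_def] using
    (Asymptotics.isBigO_refl (fun n : ℕ => (n : ℝ)) atTop).add (isLittleO_const_natCast k).isBigO

theorem exists_eventually_le_pow_of_pow_le {r : ℕ} (hr : 1 ≤ r) {a : ℕ → ℝ≥0∞} {u : ℕ → ℝ}
    {M : ℝ≥0∞} (hM : M ≠ ∞) {δ : ℝ} (hδ : 0 < δ)
    (ha : ∀ n, a (n + r) ^ r ≤ M * ENNReal.ofReal (Real.exp (u n)))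
    (hu : ∀ᶠ n : ℕ in atTop, u n ≤ -δ * n) :
    ∃ ρ : ℝ≥0, ρ < 1 ∧ ∀ᶠ n in atTop, a n ≤ (ρ : ℝ≥0∞) ^ n := by
  have hr0 : (0 : ℝ) < r := Nat.cast_pos.2 hr
  have hslack : ∀ᶠ n : ℕ in atTop, M.toReal + δ / 2 * r ≤ δ / 2 * n := by
    filter_upwards [(isLittleO_const_natCast _).bound (half_pos hδ)] with n hn
    simpa using (le_abs_self _).trans hn
  refine ⟨(Real.exp (-(δ / 2) / r)).toNNReal, ?_, ?_⟩
  · rw [Real.toNNReal_lt_one, Real.exp_lt_one_iff]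
    exact div_neg_of_neg_of_pos (by linarith) hr0
  rw [← map_add_atTop_eq_nat r, eventually_map]
  filter_upwards [hu, hslack] with n hn hn'
  refine (ENNReal.pow_le_pow_left_iff (by omega : r ≠ 0)).1 ((ha n).trans ?_)
  calc M * ENNReal.ofReal (Real.exp (u n))
      ≤ ENNReal.ofReal (Real.exp M.toReal) * ENNReal.ofReal (Real.exp (u n)) := by
        gcongr
        rw [ENNReal.le_ofReal_iff_toReal_le hM (Real.exp_nonneg _)]
        linarith [Real.add_one_le_exp M.toReal]
    _ ≤ ENNReal.ofReal (Real.exp (-(δ / 2) * (n + r : ℕ))) := by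
        rw [← ENNReal.ofReal_mul (Real.exp_nonneg _), ← Real.exp_add]
        gcongr
        push_cast
        linarith
    _ = ((Real.exp (-(δ / 2) / r)).toNNReal ^ (n + r)) ^ r := by
        change _ = (ENNReal.ofReal _ ^ _) ^ _
        rw [← ENNReal.ofReal_pow (Real.exp_nonneg _), ← ENNReal.ofReal_pow (by positivity),
          ← Real.exp_nat_mul, ← Real.exp_nat_mul]
        congr 2
        field_simp

/- The contraction gain `f` is only controlled along all times, not along multiples of `r`, so we
multiply the decay estimates of the `r` interlaced subsequences `a (i + r ℕ)`, `i < r`. -/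
theorem exists_eventually_le_pow {r : ℕ} (hr : 1 ≤ r) {a : ℕ → ℝ≥0∞} {f b : ℕ → ℝ}
    (ha0 : a 0 ≠ ∞) (har : ∀ n, a (n + r) ≤ a n * ENNReal.ofReal (Real.exp (f n)))
    (hab : ∀ n, a (n + 1) ≤ a n * ENNReal.ofReal (Real.exp (b n))) (hb0 : ∀ n, 0 ≤ b n)
    (hb : b =o[atTop] fun n : ℕ => (n : ℝ)) {δ : ℝ} (hδ : 0 < δ)
    (hf : ∀ᶠ n : ℕ in atTop, ∑ k ∈ Finset.range n, f k ≤ -δ * n) :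
    ∃ ρ : ℝ≥0, ρ < 1 ∧ ∀ᶠ n in atTop, a n ≤ (ρ : ℝ≥0∞) ^ n := by
  have ha_top : ∀ n, a n ≠ ∞ := fun n => by
    induction n with
    | zero => exact ha0
    | succ n ih => exact ne_top_of_le_ne_top (ENNReal.mul_ne_top ih ENNReal.ofReal_ne_top) (hab n)
  have hloss : (fun n => r * ∑ j ∈ Finset.range r, b (n + j)) =o[atTop] fun n : ℕ => (n : ℝ) :=
    (Asymptotics.IsLittleO.fun_sum fun j _ => isLittleO_comp_add_natCast hb j).const_mul_left _
  refine exists_eventually_le_pow_of_pow_le hr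
    (M := ∏ i ∈ Finset.range r, a i)
    (u := fun n => ∑ k ∈ Finset.range n, f k + r * ∑ j ∈ Finset.range r, b (n + j))
    (ENNReal.prod_ne_top fun i _ => ha_top i) (half_pos hδ) (fun n => ?_) ?_
  · calc a (n + r) ^ r = ∏ _i ∈ Finset.range r, a (n + r) := by simp
      _ ≤ ∏ i ∈ Finset.range r,
          (a (n + i) * ENNReal.ofReal (Real.exp (∑ j ∈ Finset.range r, b (n + j)))) := by
        refine Finset.prod_le_prod' fun i hi => ?_
        rw [ofReal_exp_sum]
        exact le_mul_prod_range
          (fun k => ENNReal.one_le_ofReal.2 (Real.one_le_exp (hb0 k))) hab n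
          (Finset.mem_range.1 hi).le
      _ = (∏ i ∈ Finset.range r, a (n + i)) *
          ENNReal.ofReal (Real.exp (r * ∑ j ∈ Finset.range r, b (n + j))) := by
        rw [Finset.prod_mul_distrib, Finset.prod_const, Finset.card_range,
          ← ENNReal.ofReal_pow (Real.exp_nonneg _), ← Real.exp_nat_mul]
      _ ≤ _ := by
        rw [Real.exp_add, ENNReal.ofReal_mul (Real.exp_nonneg _), ← mul_assoc,
          ofReal_exp_sum (Finset.range n)]
        exact mul_le_mul_left (prod_range_add_le hr har n) _
  · filter_upwards [hf, hloss.bound (half_pos hδ)] with n hn hn'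
    rw [Real.norm_eq_abs, Real.norm_natCast] at hn'
    linarith [le_abs_self (r * ∑ j ∈ Finset.range r, b (n + j))]

theorem summable_exp_mul_pow {b : ℕ → ℝ} (hb : b =o[atTop] fun n : ℕ => (n : ℝ)) {ρ : ℝ≥0}
    (hρ : ρ < 1) : Summable fun n => Real.exp (b n) * ρ ^ n := by
  obtain ⟨ε, hε, hε0⟩ : ∃ ε : ℝ, Real.exp ε * ρ < 1 ∧ 0 < ε := by
    have hcont : Tendsto (fun ε : ℝ => Real.exp ε * ρ) (𝓝[>] 0) (𝓝 (Real.exp 0 * ρ)) :=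
      ((Real.continuous_exp.mul continuous_const).tendsto 0).mono_left nhdsWithin_le_nhds
    exact ((hcont.eventually_lt_const (by simpa)).and self_mem_nhdsWithin).exists
  refine .of_norm_bounded_eventually_nat
    (summable_geometric_of_lt_one (r := Real.exp ε * ρ) (by positivity) hε) ?_
  filter_upwards [hb.bound hε0] with n hn
  rw [Real.norm_of_nonneg (by positivity), mul_pow, ← Real.exp_nat_mul]
  rw [Real.norm_eq_abs, Real.norm_natCast] at hn
  gcongr
  linarith [le_abs_self (b n)]

end Decay

/-! ### Lipschitz coefficients and iterates -/

theorem pastIterate_succ' {E : Type*} (φ : ℤ → E → E) (t : ℤ) (n : ℕ) :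
    pastIterate φ t (n + 1) = pastIterate φ t n ∘ φ (t - n) := by
  induction n generalizing t with
  | zero => simp [pastIterate]
  | succ n ih =>
    rw [pastIterate, ih, pastIterate, Function.comp_assoc]
    push_cast
    ring_nf

theorem pastIterate_add {E : Type*} (φ : ℤ → E → E) (t : ℤ) (m n : ℕ) :
    pastIterate φ t (m + n) = pastIterate φ t m ∘ pastIterate φ (t - m) n := by
  induction m generalizing t with
  | zero => simp [pastIterate]
  | succ m ih =>
    rw [Nat.add_right_comm, pastIterate, ih, pastIterate, Function.comp_assoc]
    push_cast
    ring_nf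

section Lipschitz

variable {E : Type*} [MetricSpace E] {S : Type*} [MeasurableSpace S]

theorem edist_le_lipCoeff_mul (φ : E → E) (x y : E) :
    edist (φ x) (φ y) ≤ lipCoeff φ * edist x y := by
  rcases eq_or_ne x y with rfl | h
  · simp
  · rw [← ENNReal.div_le_iff (by simpa using h) (edist_ne_top x y)]
    exact le_iSup₂_of_le x y (le_iSup (fun _ : x ≠ y => _) h)

theorem lipCoeff_le {φ : E → E} {L : ℝ≥0∞} (h : ∀ x y, edist (φ x) (φ y) ≤ L * edist x y) :
    lipCoeff φ ≤ L :=
  iSup_le fun x => iSup_le fun y => iSup_le fun _ => ENNReal.div_le_of_le_mul (h x y)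

theorem lipCoeff_le_iff_lipschitzWith {φ : E → E} {L : ℝ≥0} :
    lipCoeff φ ≤ L ↔ LipschitzWith L φ :=
  ⟨fun h x y => (edist_le_lipCoeff_mul φ x y).trans (mul_le_mul_left h _), lipCoeff_le⟩

theorem lipCoeff_comp_le (φ ψ : E → E) : lipCoeff (φ ∘ ψ) ≤ lipCoeff φ * lipCoeff ψ :=
  lipCoeff_le fun x y => calc
    edist (φ (ψ x)) (φ (ψ y)) ≤ lipCoeff φ * edist (ψ x) (ψ y) := edist_le_lipCoeff_mul φ _ _
    _ ≤ lipCoeff φ * (lipCoeff ψ * edist x y) :=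
      mul_le_mul_right (edist_le_lipCoeff_mul ψ x y) _
    _ = lipCoeff φ * lipCoeff ψ * edist x y := (mul_assoc ..).symm

theorem lipCoeff_eq_iSup_denseSeq [SeparableSpace E] [Nonempty E] {φ : E → E} (hφ : Continuous φ) :
    lipCoeff φ = ⨆ ij : ℕ × ℕ, edist (φ (denseSeq E ij.1)) (φ (denseSeq E ij.2)) /
      edist (denseSeq E ij.1) (denseSeq E ij.2) := by
  refine le_antisymm ?_ (iSup_le fun ij =>
    ENNReal.div_le_of_le_mul (edist_le_lipCoeff_mul φ _ _))
  refine le_of_forall_gt_imp_ge_of_dense fun L' hlt => ?_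
  induction L' with
  | top => exact le_top
  | coe L =>
    have hdense : LipschitzOnWith L φ (Set.range (denseSeq E)) := by
      rintro _ ⟨i, rfl⟩ _ ⟨j, rfl⟩
      rcases eq_or_ne (denseSeq E i) (denseSeq E j) with hij | hij
      · simp [hij]
      · rw [← ENNReal.div_le_iff (by simpa using hij) (edist_ne_top _ _)]
        exact iSup_le_iff.1 hlt.le (i, j)
    rw [lipCoeff_le_iff_lipschitzWith, ← lipschitzOnWith_univ,
      ← (denseRange_denseSeq E).closure_range]
    exact hdense.closure hφ.continuousOn

theorem continuous_pastIterate {φ : ℤ → E → E} (hφ : ∀ t, Continuous (φ t)) (t : ℤ) (n : ℕ) :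
    Continuous (pastIterate φ t n) := by
  induction n generalizing t with
  | zero => exact continuous_id
  | succ n ih => exact (hφ t).comp (ih _)

variable [SecondCountableTopology E] [MeasurableSpace E]

theorem measurable_lipCoeff [OpensMeasurableSpace E] {ψ : S → E → E}
    (hc : ∀ v, Continuous (ψ v)) (hm : ∀ x, Measurable fun v => ψ v x) :
    Measurable fun v => lipCoeff (ψ v) := by
  cases isEmpty_or_nonempty E
  · simp [lipCoeff]
  simp only [lipCoeff_eq_iSup_denseSeq (hc _)]
  exact .iSup fun ij => ((hm _).edist (hm _)).div_const _

theorem measurable_pastIterate [BorelSpace E] {φ : ℤ → S → E → E}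
    (hc : ∀ t v, Continuous (φ t v)) (hm : ∀ t x, Measurable fun v => φ t v x) (t : ℤ) (n : ℕ)
    (x : E) : Measurable fun v => pastIterate (fun s => φ s v) t n x := by
  induction n generalizing t with
  | zero => exact measurable_const
  | succ n ih =>
    have hjoint : Measurable (Function.uncurry fun x v => φ t v x) :=
      measurable_uncurry_of_continuous_of_measurable (hc t) (hm t)
    exact hjoint.comp ((ih (t - 1)).prodMk measurable_id)

end Lipschitz

/-! ### Logarithmic moments -/

section LogMoments

open Real (posLog)

theorem toENNReal_log {y : ℝ≥0∞} (hy : y ≠ ∞) :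
    (ENNReal.log y).toENNReal = ENNReal.ofReal (posLog y.toReal) := by
  rcases eq_or_ne y 0 with rfl | h0
  · simp
  · rw [ENNReal.log_pos_real h0 hy, EReal.real_coe_toENNReal, Real.posLog_apply,
      ENNReal.ofReal_max, ENNReal.ofReal_zero, max_eq_right zero_le]

theorem le_ofReal_exp_posLog_sub {y : ℝ≥0∞} (hy : y ≠ ∞) {a : ℝ≥0}
    (ha : a ≤ (-ENNReal.log y).toENNReal) :
    y ≤ ENNReal.ofReal (Real.exp (posLog y.toReal - a)) := by
  rcases eq_or_ne y 0 with rfl | h0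
  · exact zero_le
  have hpos : 0 < y.toReal := ENNReal.toReal_pos h0 hy
  have ha' : (a : ℝ) ≤ posLog y.toReal⁻¹ := by
    rwa [← ENNReal.log_inv, toENNReal_log (ENNReal.inv_ne_top.2 h0), ENNReal.toReal_inv,
      ← ENNReal.ofReal_coe_nnreal, ENNReal.ofReal_le_ofReal_iff Real.posLog_nonneg] at ha
  rw [ENNReal.le_ofReal_iff_toReal_le hy (Real.exp_nonneg _), ← Real.log_le_iff_le_exp hpos,
    ← Real.posLog_sub_posLog_inv]
  linarith

theorem le_ofReal_exp_posLog {y : ℝ≥0∞} (hy : y ≠ ∞) :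
    y ≤ ENNReal.ofReal (Real.exp (posLog y.toReal)) := by
  simpa using le_ofReal_exp_posLog_sub (a := 0) hy zero_le

variable {S : Type*} [MeasurableSpace S] {P : Measure S} {Y : S → ℝ≥0∞}

theorem ae_ne_top_of_meanLogPos (hY : Measurable Y) (h : meanLogPos P Y < ∞) :
    ∀ᵐ x ∂P, Y x ≠ ∞ := by
  filter_upwards [ae_lt_top hY.ennreal_log.ereal_toENNReal h.ne] with x hx htop
  simp [htop] at hx

theorem ae_le_ofReal_exp_posLog (hY : Measurable Y) (h : meanLogPos P Y < ∞) :
    ∀ᵐ x ∂P, Y x ≤ ENNReal.ofReal (Real.exp (posLog (Y x).toReal)) :=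
  (ae_ne_top_of_meanLogPos hY h).mono fun _ => le_ofReal_exp_posLog

theorem meanLogPos_eq_lintegral_posLog (hY : ∀ᵐ x ∂P, Y x ≠ ∞) :
    meanLogPos P Y = ∫⁻ x, ENNReal.ofReal (posLog (Y x).toReal) ∂P :=
  lintegral_congr_ae (hY.mono fun _ => toENNReal_log)

theorem measurable_posLog_toReal (hY : Measurable Y) : Measurable fun x => posLog (Y x).toReal :=
  Real.continuous_posLog.measurable.comp hY.ennreal_toReal

theorem integrable_posLog_of_meanLogPos (hY : Measurable Y) (h : meanLogPos P Y < ∞) :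
    Integrable (fun x => posLog (Y x).toReal) P := by
  refine ⟨(measurable_posLog_toReal hY).aestronglyMeasurable,
    (hasFiniteIntegral_iff_ofReal (ae_of_all _ fun _ => Real.posLog_nonneg)).2 ?_⟩
  rwa [← meanLogPos_eq_lintegral_posLog (ae_ne_top_of_meanLogPos hY h)]

theorem exists_integrable_minorant [IsFiniteMeasure P] {g : S → ℝ≥0∞} {m : ℝ}
    (h : ENNReal.ofReal m < ∫⁻ x, g x ∂P) :
    ∃ f : S → ℝ≥0, Measurable f ∧ Integrable (fun x => (f x : ℝ)) P ∧ m < ∫ x, (f x : ℝ) ∂P ∧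
      ∀ x, f x ≤ g x := by
  rw [lintegral_eq_nnreal] at h
  obtain ⟨f, hf⟩ := lt_iSup_iff.1 h
  obtain ⟨hle, hf⟩ := lt_iSup_iff.1 hf
  have hint : Integrable (fun x => (f x : ℝ)) P :=
    (f.map ((↑) : ℝ≥0 → ℝ)).integrable_of_isFiniteMeasure
  refine ⟨f, f.measurable, hint, ?_, hle⟩
  have heq : (f.map ((↑) : ℝ≥0 → ℝ≥0∞)).lintegral P = ENNReal.ofReal (∫ x, (f x : ℝ) ∂P) := by
    rw [← SimpleFunc.lintegral_eq_lintegral,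
      ofReal_integral_eq_lintegral_ofReal hint (ae_of_all _ fun _ => NNReal.coe_nonneg _)]
    simp
  exact (ENNReal.ofReal_lt_ofReal_iff'.1 (heq ▸ hf)).1

theorem MeanLogNegative.exists_le_ofReal_exp [IsFiniteMeasure P] (h : MeanLogNegative P Y)
    (hY : Measurable Y) :
    ∃ f : S → ℝ, Measurable f ∧ Integrable f P ∧ ∫ x, f x ∂P < 0 ∧
      ∀ᵐ x ∂P, Y x ≤ ENNReal.ofReal (Real.exp (f x)) := by
  have hpos : meanLogPos P Y < ∞ := h.trans_le le_top
  have hY_top := ae_ne_top_of_meanLogPos hY hpos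
  have hint := integrable_posLog_of_meanLogPos hY hpos
  rw [MeanLogNegative, meanLogPos_eq_lintegral_posLog hY_top,
    ← ofReal_integral_eq_lintegral_ofReal hint (ae_of_all _ fun _ => Real.posLog_nonneg)] at h
  obtain ⟨φ, hφm, hφi, hlt, hle⟩ := exists_integrable_minorant h
  refine ⟨fun x => posLog (Y x).toReal - φ x,
    (measurable_posLog_toReal hY).sub hφm.coe_nnreal_real, hint.sub hφi, ?_, ?_⟩
  · rwa [integral_sub hint hφi, sub_neg]
  · filter_upwards [hY_top] with x hx using le_ofReal_exp_posLog_sub hx (hle x)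

end LogMoments

/-! ### Shifts of the path space -/

/-- The shift by `t ∈ ℤ` on two-sided sequences, `seqShift` being the shift by one. -/
def shiftBy {F : Type*} (t : ℤ) (v : ℤ → F) : ℤ → F := fun s => v (s + t)

section Shift

variable {F : Type*}

@[simp] theorem shiftBy_apply (t s : ℤ) (v : ℤ → F) : shiftBy t v s = v (s + t) := rfl

@[simp] theorem shiftBy_shiftBy (s t : ℤ) (v : ℤ → F) :
    shiftBy s (shiftBy t v) = shiftBy (s + t) v := by
  funext u
  simp [add_assoc]

@[simp] theorem shiftBy_zero (v : ℤ → F) : shiftBy 0 v = v := by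
  funext u
  simp

theorem seqShift_eq_shiftBy : (seqShift : (ℤ → F) → ℤ → F) = shiftBy 1 := rfl

theorem iterate_shiftBy (t : ℤ) (n : ℕ) (v : ℤ → F) : (shiftBy t)^[n] v = shiftBy (n * t) v := by
  induction n with
  | zero => simp
  | succ n ih =>
    rw [Function.iterate_succ_apply', ih, shiftBy_shiftBy]
    push_cast
    ring_nf

variable [MeasurableSpace F]

theorem measurable_shiftBy (t : ℤ) : Measurable (shiftBy t : (ℤ → F) → ℤ → F) :=
  measurable_pi_lambda _ fun s => measurable_pi_apply (s + t)

/-- The shift as a measurable equivalence, which makes its inverse available. -/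
def seqShiftEquiv (F : Type*) [MeasurableSpace F] : (ℤ → F) ≃ᵐ (ℤ → F) where
  toFun := seqShift
  invFun := shiftBy (-1)
  left_inv v := by simp [seqShift_eq_shiftBy]
  right_inv v := by simp [seqShift_eq_shiftBy]
  measurable_toFun := measurable_shiftBy 1
  measurable_invFun := measurable_shiftBy (-1)

variable {P : Measure (ℤ → F)}

theorem ergodic_shiftBy_neg_one (hP : Ergodic seqShift P) : Ergodic (shiftBy (-1)) P :=
  Ergodic.symm (e := seqShiftEquiv F) hP

theorem measurePreserving_shiftBy (hP : MeasurePreserving seqShift P P) (t : ℤ) :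
    MeasurePreserving (shiftBy t) P P := by
  have hneg : MeasurePreserving (shiftBy (-1)) P P :=
    MeasurePreserving.symm (seqShiftEquiv F) hP
  rcases Int.eq_nat_or_neg t with ⟨n, rfl | rfl⟩
  · convert hP.iterate n using 1
    funext v
    simp [seqShift_eq_shiftBy, iterate_shiftBy]
  · convert hneg.iterate n using 1
    funext v
    simp [iterate_shiftBy]

theorem ae_forall_shiftBy (hP : MeasurePreserving seqShift P P) {p : (ℤ → F) → Prop}
    (h : ∀ᵐ v ∂P, p v) : ∀ᵐ v ∂P, ∀ t, p (shiftBy t v) :=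
  ae_all_iff.2 fun t => (measurePreserving_shiftBy hP t).quasiMeasurePreserving.ae h

variable [IsProbabilityMeasure P] {f : (ℤ → F) → ℝ}

theorem ae_isLittleO_shiftBy (hP : Ergodic seqShift P) (hm : Measurable f)
    (hf : Integrable f P) :
    ∀ᵐ v ∂P, ∀ t, (fun n : ℕ => f (shiftBy (n + t) v)) =o[atTop] fun n : ℕ => (n : ℝ) := by
  filter_upwards [ae_forall_shiftBy hP.toMeasurePreserving
    (ae_isLittleO_comp_iterate hP hm hf)] with v hv t
  simpa [seqShift_eq_shiftBy, iterate_shiftBy] using hv t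

theorem ae_isLittleO_shiftBy_neg (hP : Ergodic seqShift P) (hm : Measurable f)
    (hf : Integrable f P) :
    ∀ᵐ v ∂P, ∀ t, (fun n : ℕ => f (shiftBy (-n + t) v)) =o[atTop] fun n : ℕ => (n : ℝ) := by
  filter_upwards [ae_forall_shiftBy hP.toMeasurePreserving
    (ae_isLittleO_comp_iterate (ergodic_shiftBy_neg_one hP) hm hf)] with v hv t
  simpa [iterate_shiftBy] using hv t

theorem ae_sum_shiftBy_le (hP : Ergodic seqShift P) (hm : Measurable f) (hf : Integrable f P)
    (hneg : ∫ v, f v ∂P < 0) :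
    ∀ᵐ v ∂P, ∀ t, ∃ δ > 0, ∀ᶠ n : ℕ in atTop,
      ∑ k ∈ Finset.range n, f (shiftBy (k + t) v) ≤ -δ * n := by
  filter_upwards [ae_forall_shiftBy hP.toMeasurePreserving
    (ae_birkhoffSum_le_neg_mul hP hm hf hneg)] with v hv t
  simpa [birkhoffSum, seqShift_eq_shiftBy, iterate_shiftBy] using hv t

theorem ae_sum_shiftBy_neg_le (hP : Ergodic seqShift P) (hm : Measurable f)
    (hf : Integrable f P) (hneg : ∫ v, f v ∂P < 0) :
    ∀ᵐ v ∂P, ∀ t, ∃ δ > 0, ∀ᶠ n : ℕ in atTop,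
      ∑ k ∈ Finset.range n, f (shiftBy (-k + t) v) ≤ -δ * n := by
  filter_upwards [ae_forall_shiftBy hP.toMeasurePreserving
    (ae_birkhoffSum_le_neg_mul (ergodic_shiftBy_neg_one hP) hm hf hneg)] with v hv t
  simpa [birkhoffSum, iterate_shiftBy] using hv t

end Shift

/-! ### Stochastic recurrence equations that contract on average -/

/-- The maps `ψ_t : E → E` that a random map `ψ` on the path space gives along the path `v`. -/
def mapsAlong {F E : Type*} (ψ : (ℤ → F) → E → E) (v : ℤ → F) : ℤ → E → E :=
  fun t => ψ (shiftBy t v)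

/-- The limit `lim_n ψ_{-1} ∘ ⋯ ∘ ψ_{-n} (s)` of the backward iterates along the path `v`; a junk
value if there is none. It is the time-`0` value of the stationary solution of
`x_{t+1} = ψ_t (x_t)`. -/
noncomputable def backwardLimit {F E : Type*} [TopologicalSpace E] (ψ : (ℤ → F) → E → E) (s : E)
    (v : ℤ → F) : E :=
  haveI : Nonempty E := ⟨s⟩
  limUnder atTop fun n => pastIterate (mapsAlong ψ v) (-1) n s

/-- The recursion `x_{t+1} = ψ_t (x_t)` is driven by an ergodic sequence and contracts on average:
the `ψ_t` are random Lipschitz maps, `E[log⁺ Λ(ψ_0)] < ∞` and `E[log Λ(ψ_0 ∘ ⋯ ∘ ψ_{-r+1})] < 0`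
for some `r ≥ 1`. -/
structure IsContractiveOnAverage {F E : Type*} [MeasurableSpace F] [MetricSpace E]
    [MeasurableSpace E] (P : Measure (ℤ → F)) (ψ : (ℤ → F) → E → E) : Prop where
  ergodic : Ergodic seqShift P
  continuous : ∀ v, Continuous (ψ v)
  measurable : ∀ x, Measurable fun v => ψ v x
  meanLogPos_lt_top : meanLogPos P (fun v => lipCoeff (ψ v)) < ∞
  exists_meanLogNegative :
    ∃ r, 1 ≤ r ∧ MeanLogNegative P fun v => lipCoeff (pastIterate (mapsAlong ψ v) 0 r)

section Recursion

variable {F E : Type*} {ψ : (ℤ → F) → E → E}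

theorem pastIterate_mapsAlong_shiftBy (ψ : (ℤ → F) → E → E) (t u : ℤ) (n : ℕ) (v : ℤ → F) :
    pastIterate (mapsAlong ψ (shiftBy t v)) u n = pastIterate (mapsAlong ψ v) (u + t) n := by
  induction n generalizing u with
  | zero => rfl
  | succ n ih => simp only [pastIterate, ih, mapsAlong, shiftBy_shiftBy, sub_add_eq_add_sub]

theorem pastIterate_congr {φ φ' : ℤ → E → E} {t : ℤ} (h : ∀ s ≤ t, φ s = φ' s) (n : ℕ) :
    pastIterate φ t n = pastIterate φ' t n := by
  induction n generalizing t with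
  | zero => rfl
  | succ n ih => rw [pastIterate, pastIterate, h t le_rfl, ih fun s hs => h s (by omega)]

theorem eq_pastIterate_of_recursion {φ : ℤ → E → E} {x : ℕ → E}
    (hx : ∀ n : ℕ, x (n + 1) = φ n (x n)) (n : ℕ) : x n = pastIterate φ (n - 1) n (x 0) := by
  induction n with
  | zero => rfl
  | succ n ih => simp [hx, pastIterate, ← ih]

theorem backwardLimit_congr [TopologicalSpace E] {s : E} {v w : ℤ → F}
    (h : ∀ t < 0, ψ (shiftBy t v) = ψ (shiftBy t w)) :
    backwardLimit ψ s v = backwardLimit ψ s w := by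
  have key := pastIterate_congr (φ := mapsAlong ψ v) (φ' := mapsAlong ψ w) (t := -1)
    fun t ht => h t (by omega)
  simp only [backwardLimit, key]

variable [MeasurableSpace F] {P : Measure (ℤ → F)} [MetricSpace E] [SecondCountableTopology E]
  [MeasurableSpace E] [BorelSpace E]

theorem measurable_backwardLimit [CompleteSpace E] (hc : ∀ v, Continuous (ψ v))
    (hm : ∀ x, Measurable fun v => ψ v x) (s : E) : Measurable (backwardLimit ψ s) := by
  have : Nonempty E := ⟨s⟩
  exact (StronglyMeasurable.limUnder fun n => (measurable_pastIterate (fun t v => hc _)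
    (fun t x => (hm x).comp (measurable_shiftBy t)) (-1) n s).stronglyMeasurable).measurable

namespace IsContractiveOnAverage

variable [IsProbabilityMeasure P] (h : IsContractiveOnAverage P ψ)
include h

theorem exists_log_bounds :
    ∃ r, 1 ≤ r ∧ ∃ b f : (ℤ → F) → ℝ, Measurable b ∧ Integrable b P ∧ (∀ v, 0 ≤ b v) ∧
      Measurable f ∧ Integrable f P ∧ ∫ v, f v ∂P < 0 ∧ ∀ᵐ v ∂P, ∀ t,
        lipCoeff (mapsAlong ψ v t) ≤ ENNReal.ofReal (Real.exp (b (shiftBy t v))) ∧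
        lipCoeff (pastIterate (mapsAlong ψ v) t r) ≤
          ENNReal.ofReal (Real.exp (f (shiftBy t v))) := by
  obtain ⟨r, hr, hneg⟩ := h.exists_meanLogNegative
  have hlip := measurable_lipCoeff h.continuous h.measurable
  obtain ⟨f, hfm, hfi, hf0, hf⟩ := hneg.exists_le_ofReal_exp <|
    measurable_lipCoeff (fun v => continuous_pastIterate (fun t => h.continuous _) 0 r)
      (measurable_pastIterate (fun t v => h.continuous _)
        (fun t x => (h.measurable x).comp (measurable_shiftBy t)) 0 r)
  refine ⟨r, hr, _, f, measurable_posLog_toReal hlip,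
    integrable_posLog_of_meanLogPos hlip h.meanLogPos_lt_top, fun v => Real.posLog_nonneg,
    hfm, hfi, hf0, ?_⟩
  filter_upwards [ae_forall_shiftBy h.ergodic.toMeasurePreserving
      (ae_le_ofReal_exp_posLog hlip h.meanLogPos_lt_top),
    ae_forall_shiftBy h.ergodic.toMeasurePreserving hf] with v hv hv' t
  exact ⟨hv t, by simpa only [pastIterate_mapsAlong_shiftBy, zero_add] using hv' t⟩

theorem ae_lipschitzWith_forward :
    ∀ᵐ v ∂P, ∃ ρ : ℝ≥0, ρ < 1 ∧ ∀ᶠ n : ℕ in atTop,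
      LipschitzWith (ρ ^ n) (pastIterate (mapsAlong ψ v) (n - 1) n) := by
  obtain ⟨r, hr, b, f, hbm, hbi, hb0, hfm, hfi, hf0, hbound⟩ := h.exists_log_bounds
  filter_upwards [hbound, ae_isLittleO_shiftBy h.ergodic hbm hbi,
    ae_sum_shiftBy_le h.ergodic hfm hfi hf0] with v hv hb hf
  obtain ⟨δ, hδ, hf⟩ := hf (r - 1)
  simp only [← lipCoeff_le_iff_lipschitzWith, ENNReal.coe_pow]
  refine exists_eventually_le_pow (a := fun n => lipCoeff (pastIterate (mapsAlong ψ v) (n - 1) n))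
    hr (b := fun n => b (shiftBy n v)) ?_ (fun n => ?_) (fun n => ?_) (fun n => hb0 _)
    (by simpa using hb 0) hδ hf
  · exact ne_top_of_le_ne_top ENNReal.one_ne_top
      (lipCoeff_le_iff_lipschitzWith (L := 1).2 LipschitzWith.id)
  · rw [add_comm n r, pastIterate_add, mul_comm]
    have hlast : ((r + n : ℕ) : ℤ) - 1 = n + (r - 1) := by omega
    have hfirst : (n + (r - 1) : ℤ) - r = n - 1 := by ring
    rw [hlast, hfirst]
    exact (lipCoeff_comp_le _ _).trans (mul_le_mul_left (hv _).2 _)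
  · rw [pastIterate, mul_comm]
    rw [Nat.cast_succ, add_sub_cancel_right]
    exact (lipCoeff_comp_le _ _).trans (mul_le_mul_left (hv _).1 _)

theorem ae_lipschitzWith_backward :
    ∀ᵐ v ∂P, ∃ ρ : ℝ≥0, ρ < 1 ∧ ∀ᶠ n : ℕ in atTop,
      LipschitzWith (ρ ^ n) (pastIterate (mapsAlong ψ v) (-1) n) := by
  obtain ⟨r, hr, b, f, hbm, hbi, hb0, hfm, hfi, hf0, hbound⟩ := h.exists_log_bounds
  filter_upwards [hbound, ae_isLittleO_shiftBy_neg h.ergodic hbm hbi,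
    ae_sum_shiftBy_neg_le h.ergodic hfm hfi hf0] with v hv hb hf
  obtain ⟨δ, hδ, hf⟩ := hf (-1)
  simp only [← lipCoeff_le_iff_lipschitzWith, ENNReal.coe_pow]
  refine exists_eventually_le_pow (a := fun n => lipCoeff (pastIterate (mapsAlong ψ v) (-1) n))
    hr ?_ (fun n => ?_) (fun n => ?_) (fun n => hb0 _) (hb (-1)) hδ hf
  · exact ne_top_of_le_ne_top ENNReal.one_ne_top
      (lipCoeff_le_iff_lipschitzWith (L := 1).2 LipschitzWith.id)
  · rw [pastIterate_add, sub_eq_neg_add]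
    exact (lipCoeff_comp_le _ _).trans (mul_le_mul_right (hv _).2 _)
  · rw [pastIterate_succ', sub_eq_neg_add]
    exact (lipCoeff_comp_le _ _).trans (mul_le_mul_right (hv _).1 _)

theorem ae_cauchySeq_pastIterate {s s' : E} (hinit : meanLogPos P (fun v => edist (ψ v s) s') < ∞) :
    ∀ᵐ v ∂P, CauchySeq fun n => pastIterate (mapsAlong ψ v) (-1) n s := by
  have hm : Measurable fun v => edist (ψ v s) s' := (h.measurable s).edist measurable_const
  filter_upwards [h.ae_lipschitzWith_backward,
    ae_forall_shiftBy h.ergodic.toMeasurePreserving (ae_le_ofReal_exp_posLog hm hinit),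
    ae_isLittleO_shiftBy_neg h.ergodic (measurable_posLog_toReal hm)
      (integrable_posLog_of_meanLogPos hm hinit)] with v ⟨ρ, hρ, hlip⟩ hdist hlog
  set c : ℕ → ℝ := fun n => Real.posLog (edist (mapsAlong ψ v (-n + -1) s) s').toReal
  have hsum : Summable fun n : ℕ => Real.exp (c n) * ρ ^ n + dist s' s * ρ ^ n :=
    (summable_exp_mul_pow (hlog (-1)) hρ).add
      ((summable_geometric_of_lt_one ρ.2 hρ).mul_left _)
  refine cauchySeq_of_summable_dist (.of_norm_bounded_eventually_nat hsum ?_)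
  filter_upwards [hlip] with n hn
  have hstep : dist (mapsAlong ψ v (-n + -1) s) s' ≤ Real.exp (c n) := by
    rw [← ENNReal.ofReal_le_ofReal_iff (Real.exp_nonneg _), ← edist_dist]
    exact hdist (-n + -1)
  calc ‖dist (pastIterate (mapsAlong ψ v) (-1) n s) (pastIterate (mapsAlong ψ v) (-1) (n + 1) s)‖
      = dist (pastIterate (mapsAlong ψ v) (-1) n (mapsAlong ψ v (-n + -1) s))
          (pastIterate (mapsAlong ψ v) (-1) n s) := by
        rw [Real.norm_of_nonneg dist_nonneg, pastIterate_succ', Function.comp_apply, dist_comm,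
          sub_eq_neg_add]
    _ ≤ ρ ^ n * dist (mapsAlong ψ v (-n + -1) s) s := by
        simpa using hn.dist_le_mul (mapsAlong ψ v (-n + -1) s) s
    _ ≤ ρ ^ n * (Real.exp (c n) + dist s' s) := by
        gcongr
        exact (dist_triangle _ s' _).trans (by gcongr)
    _ = Real.exp (c n) * ρ ^ n + dist s' s * ρ ^ n := by ring

theorem ae_backwardLimit_succ [CompleteSpace E] {s s' : E}
    (hinit : meanLogPos P (fun v => edist (ψ v s) s') < ∞) :
    ∀ᵐ v ∂P, ∀ t, backwardLimit ψ s (shiftBy (t + 1) v) =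
      ψ (shiftBy t v) (backwardLimit ψ s (shiftBy t v)) := by
  filter_upwards [ae_forall_shiftBy h.ergodic.toMeasurePreserving
    (h.ae_cauchySeq_pastIterate hinit)] with v hv t
  have hnext := (CauchySeq.tendsto_limUnder (hv (t + 1))).comp (tendsto_add_atTop_nat 1)
  have himage := ((h.continuous (shiftBy t v)).tendsto _).comp (CauchySeq.tendsto_limUnder (hv t))
  refine tendsto_nhds_unique hnext (himage.congr fun n => ?_)
  simp only [Function.comp_apply, pastIterate_mapsAlong_shiftBy, pastIterate, mapsAlong]
  ring_nf

theorem ae_dist_le_pow :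
    ∀ᵐ v ∂P, ∀ x y : ℕ → E, (∀ n : ℕ, x (n + 1) = ψ (shiftBy n v) (x n)) →
      (∀ n : ℕ, y (n + 1) = ψ (shiftBy n v) (y n)) →
      ∃ ρ : ℝ≥0, ρ < 1 ∧ ∀ᶠ n : ℕ in atTop, dist (x n) (y n) ≤ ρ ^ n * dist (x 0) (y 0) := by
  filter_upwards [h.ae_lipschitzWith_forward] with v ⟨ρ, hρ, hlip⟩ x y hx hy
  refine ⟨ρ, hρ, hlip.mono fun n hn => ?_⟩
  rw [eq_pastIterate_of_recursion (φ := mapsAlong ψ v) hx n,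
    eq_pastIterate_of_recursion (φ := mapsAlong ψ v) hy n]
  simpa using hn.dist_le_mul (x 0) (y 0)

end IsContractiveOnAverage

end Recursion

/-! ### Minimum contrast estimation -/

section Contrast

variable {K : Type*} [MetricSpace K]

theorem iInf₂_denseSeq_eq [SeparableSpace K] [Nonempty K] {f : K → ℝ≥0∞} (hf : Continuous f)
    {U : Set K} (hU : IsOpen U) :
    ⨅ (i : ℕ) (_ : denseSeq K i ∈ U), f (denseSeq K i) = ⨅ θ ∈ U, f θ := by
  refine le_antisymm (le_iInf₂ fun θ hθ => ?_) (le_iInf₂ fun i hi => iInf₂_le _ hi)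
  have hsub : U ∩ Set.range (denseSeq K) ⊆
      {θ | ⨅ (i : ℕ) (_ : denseSeq K i ∈ U), f (denseSeq K i) ≤ f θ} := by
    rintro _ ⟨hi, i, rfl⟩
    exact iInf₂_le (f := fun j (_ : denseSeq K j ∈ U) => f (denseSeq K j)) i hi
  exact closure_minimal hsub (isClosed_le continuous_const hf)
    ((denseRange_denseSeq K).open_subset_closure_inter hU hθ)

theorem iSup_iInf_ball_eq {f : K → ℝ≥0∞} (hf : Continuous f) (θ : K) :
    ⨆ k : ℕ, ⨅ θ' ∈ Metric.ball θ (1 / ((k : ℝ) + 1)), f θ' = f θ := by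
  rw [← (hf.tendsto θ).liminf_eq, Metric.nhds_basis_ball_inv_nat_succ.liminf_eq_iSup_iInf]
  simp

variable {S : Type*} [MeasurableSpace S] {P : Measure S} [IsProbabilityMeasure P]

theorem exists_nhds_integrable_minorant [SeparableSpace K] {g : S → K → ℝ≥0∞}
    (hc : ∀ v, Continuous (g v)) (hm : ∀ θ, Measurable fun v => g v θ) {θ : K} {m : ℝ}
    (hθ : ENNReal.ofReal m < ∫⁻ v, g v θ ∂P) :
    ∃ U ∈ 𝓝 θ, ∃ f : S → ℝ≥0, Measurable f ∧ Integrable (fun v => (f v : ℝ)) P ∧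
      m < ∫ v, (f v : ℝ) ∂P ∧ ∀ v, ∀ θ' ∈ U, f v ≤ g v θ' := by
  have : Nonempty K := ⟨θ⟩
  let B : ℕ → Set K := fun k => Metric.ball θ (1 / ((k : ℝ) + 1))
  have hImeas : ∀ k, Measurable fun v => ⨅ θ' ∈ B k, g v θ' := fun k => by
    simp only [← iInf₂_denseSeq_eq (hc _) Metric.isOpen_ball, B]
    exact .iInf fun i => .iInf fun _ => hm _
  have hImono : Monotone fun k v => ⨅ θ' ∈ B k, g v θ' := fun k l hkl v =>
    biInf_mono (Metric.ball_subset_ball (Nat.one_div_le_one_div hkl))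
  simp only [← iSup_iInf_ball_eq (hc _) θ] at hθ
  rw [lintegral_iSup hImeas hImono] at hθ
  obtain ⟨k, hk⟩ := lt_iSup_iff.1 hθ
  obtain ⟨f, hfm, hfi, hlt, hle⟩ := exists_integrable_minorant hk
  exact ⟨B k, Metric.ball_mem_nhds _ (by positivity), f, hfm, hfi, hlt,
    fun v θ' hθ' => (hle v).trans (iInf₂_le θ' hθ')⟩

variable {τ : S → S} {ℓ : S → K → ℝ} {θ₀ : K}

theorem exists_nhds_birkhoffSum_gap [SeparableSpace K] (hτ : Ergodic τ P)
    (hc : ∀ v, Continuous (ℓ v)) (hm : ∀ θ, Measurable fun v => ℓ v θ) (h0 : ∀ v θ, 0 ≤ ℓ v θ)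
    (hi : Integrable (fun v => ℓ v θ₀) P) {θ : K}
    (hlt : ∫⁻ v, ENNReal.ofReal (ℓ v θ₀) ∂P < ∫⁻ v, ENNReal.ofReal (ℓ v θ) ∂P) :
    ∃ U ∈ 𝓝 θ, ∀ᵐ v ∂P, ∃ δ > 0, ∀ᶠ n : ℕ in atTop, ∀ θ' ∈ U,
      birkhoffSum τ (ℓ · θ₀) n v + δ * n ≤ birkhoffSum τ (ℓ · θ') n v := by
  rw [← ofReal_integral_eq_lintegral_ofReal hi (ae_of_all _ fun v => h0 v θ₀)] at hlt
  obtain ⟨U, hU, f, hfm, hfi, hflt, hfle⟩ := exists_nhds_integrable_minorant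
    (fun v => ENNReal.continuous_ofReal.comp (hc v)) (fun θ => (hm θ).ennreal_ofReal) hlt
  refine ⟨U, hU, ?_⟩
  filter_upwards [ae_birkhoffSum_le_neg_mul hτ ((hm θ₀).sub hfm.coe_nnreal_real) (hi.sub hfi) (by
    simpa only [Pi.sub_apply, integral_sub hi hfi, sub_neg] using hflt)] with v ⟨δ, hδ, hsum⟩
  refine ⟨δ, hδ, hsum.mono fun n hn θ' hθ' => ?_⟩
  have hle : birkhoffSum τ (fun w => (f w : ℝ)) n v ≤ birkhoffSum τ (ℓ · θ') n v :=
    Finset.sum_le_sum fun k _ => (Real.le_toNNReal_iff_coe_le (h0 _ _)).1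
      (ENNReal.coe_le_coe.1 (hfle (τ^[k] v) θ' hθ'))
  rw [birkhoffSum_sub] at hn
  linarith

theorem ae_birkhoffSum_gap [SeparableSpace K] (hτ : Ergodic τ P) (hc : ∀ v, Continuous (ℓ v))
    (hm : ∀ θ, Measurable fun v => ℓ v θ) (h0 : ∀ v θ, 0 ≤ ℓ v θ)
    (hi : Integrable (fun v => ℓ v θ₀) P) {C : Set K} (hC : IsCompact C)
    (hlt : ∀ θ ∈ C, ∫⁻ v, ENNReal.ofReal (ℓ v θ₀) ∂P < ∫⁻ v, ENNReal.ofReal (ℓ v θ) ∂P) :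
    ∀ᵐ v ∂P, ∃ δ > 0, ∀ᶠ n : ℕ in atTop, ∀ θ ∈ C,
      birkhoffSum τ (ℓ · θ₀) n v + δ * n ≤ birkhoffSum τ (ℓ · θ) n v := by
  have hlocal : ∀ θ ∈ C, ∃ U ∈ 𝓝[C] θ, ∀ᵐ v ∂P, ∃ δ > 0, ∀ᶠ n : ℕ in atTop, ∀ θ' ∈ U,
      birkhoffSum τ (ℓ · θ₀) n v + δ * n ≤ birkhoffSum τ (ℓ · θ') n v := fun θ hθ =>
    let ⟨U, hU, h⟩ := exists_nhds_birkhoffSum_gap hτ hc hm h0 hi (hlt θ hθ)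
    ⟨U, mem_nhdsWithin_of_mem_nhds hU, h⟩
  refine hC.induction_on ?_ (fun A B hAB hB => ?_) (fun A B hA hB => ?_) hlocal
  · exact ae_of_all _ fun v => ⟨1, one_pos, by simp⟩
  · filter_upwards [hB] with v ⟨δ, hδ, h⟩
    exact ⟨δ, hδ, h.mono fun n hn θ hθ => hn θ (hAB hθ)⟩
  · filter_upwards [hA, hB] with v ⟨δ, hδ, h⟩ ⟨δ', hδ', h'⟩
    refine ⟨min δ δ', lt_min hδ hδ', ?_⟩
    filter_upwards [h, h'] with n hn hn' θ hθ
    rcases hθ with hθ | hθ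
    · exact le_trans (by gcongr; exact min_le_left _ _) (hn θ hθ)
    · exact le_trans (by gcongr; exact min_le_right _ _) (hn' θ hθ)

theorem ae_forall_tendsto_of_near_minimizer [CompactSpace K] (hτ : Ergodic τ P)
    (hc : ∀ v, Continuous (ℓ v)) (hm : ∀ θ, Measurable fun v => ℓ v θ) (h0 : ∀ v θ, 0 ≤ ℓ v θ)
    (hi : Integrable (fun v => ℓ v θ₀) P)
    (hlt : ∀ θ ≠ θ₀, ∫⁻ v, ENNReal.ofReal (ℓ v θ₀) ∂P < ∫⁻ v, ENNReal.ofReal (ℓ v θ) ∂P) :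
    ∀ᵐ v ∂P, ∀ (θhat : ℕ → K) (e : ℕ → ℝ), e =o[atTop] (fun n : ℕ => (n : ℝ)) →
      (∀ᶠ n in atTop, birkhoffSum τ (ℓ · (θhat n)) n v ≤ birkhoffSum τ (ℓ · θ₀) n v + e n) →
      Tendsto θhat atTop (𝓝 θ₀) := by
  have hgap : ∀ k : ℕ, ∀ᵐ v ∂P, ∃ δ > 0, ∀ᶠ n : ℕ in atTop,
      ∀ θ ∈ (Metric.ball θ₀ (1 / ((k : ℝ) + 1)))ᶜ,
        birkhoffSum τ (ℓ · θ₀) n v + δ * n ≤ birkhoffSum τ (ℓ · θ) n v := fun k =>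
    ae_birkhoffSum_gap hτ hc hm h0 hi Metric.isOpen_ball.isClosed_compl.isCompact
      fun θ hθ => hlt θ fun h => hθ (h ▸ Metric.mem_ball_self (by positivity))
  filter_upwards [ae_all_iff.2 hgap] with v hv θhat e he hnear
  refine Metric.nhds_basis_ball_inv_nat_succ.tendsto_right_iff.2 fun k _ => ?_
  obtain ⟨δ, hδ, hsep⟩ := hv k
  filter_upwards [hsep, hnear, he.bound (half_pos hδ), eventually_gt_atTop 0]
    with n hn hn' hen hn0
  by_contra hfar
  rw [Real.norm_eq_abs, Real.norm_natCast] at hen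
  have : 0 < δ * n := mul_pos hδ (Nat.cast_pos.2 hn0)
  linarith [hn _ hfar, le_abs_self (e n)]

end Contrast

/-! ### The volatility recursion along a path of observations -/

theorem measurable_continuousMap_of_eval {S K Y : Type*} [MeasurableSpace S] [MetricSpace K]
    [CompactSpace K] [MetricSpace Y] [CompleteSpace Y] [SecondCountableTopology Y]
    [MeasurableSpace Y] [BorelSpace Y] {f : S → C(K, Y)} (h : ∀ θ, Measurable fun v => f v θ) :
    Measurable f := by
  have : BorelSpace C(K, Y) := ⟨rfl⟩
  rcases isEmpty_or_nonempty K with hK | hK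
  · have : Subsingleton C(K, Y) := ⟨fun _ _ => ContinuousMap.ext hK.elim⟩
    exact measurable_of_subsingleton_codomain f
  · have hc : Continuous fun (s : C(K, Y)) (i : ℕ) => s (denseSeq K i) :=
      continuous_pi fun i => continuous_eval_const _
    have hinj : Function.Injective fun (s : C(K, Y)) (i : ℕ) => s (denseSeq K i) :=
      fun s s' hss => DFunLike.coe_injective <| (denseRange_denseSeq K).equalizer s.continuous
        s'.continuous hss
    exact (hc.measurableEmbedding hinj).measurable_comp_iff.1 (measurable_pi_lambda _ fun i => h _)

theorem dist_apply_le_dist_volState {q : ℕ} (s s' : VolState q) (i : Fin q) :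
    dist (s i) (s' i) ≤ dist s s' := by
  have h := (PiLp.lipschitzWith_ofLp 2 fun _ : Fin q => ℝ≥0).dist_le_mul s s'
  rw [NNReal.coe_one, one_mul] at h
  exact (dist_le_pi_dist _ _ i).trans h

section Model

variable {d p q : ℕ} {Θ : Set (EuclideanSpace ℝ (Fin d))}
  {g : Θ → (Fin p → ℝ) → VolState q → ℝ≥0} {K : Compacts Θ}

theorem obsVec_shiftBy (t u : ℤ) (v : ℤ → ℝ) :
    obsVec p Function.eval u (shiftBy t v) = obsVec p Function.eval (u + t) v := by
  funext i
  simp only [obsVec, Function.eval, shiftBy_apply, sub_add_eq_add_sub]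

theorem measurable_obsVec_eval (t : ℤ) : Measurable (obsVec p Function.eval t) :=
  measurable_pi_lambda _ fun _ => measurable_pi_apply _

variable (hg : ∀ x, Continuous fun a : K × VolState q => g a.1 x a.2)

include hg in
theorem continuous_nextVol {Ω : Type*} (X : ℤ → Ω → ℝ) (t : ℤ) (ω : Ω) (s : C(K, VolState q)) :
    Continuous (nextVol g K X t ω s) :=
  (hg _).comp (continuous_id.prodMk s.continuous)

theorem abs_nextVol_sub_le {Ω : Type*} (X : ℤ → Ω → ℝ) (t : ℤ) (ω : Ω) (s s' : C(K, VolState q))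
    (θ : K) : |(nextVol g K X t ω s θ : ℝ) - nextVol g K X t ω s' θ| ≤
      dist (sreMap g K hg X t ω s) (sreMap g K hg X t ω s') := by
  rcases Nat.eq_zero_or_pos q with rfl | hq
  · simp [Subsingleton.elim s s']
  · rw [nextVol_eq_first_coord g K hg X t ω s θ hq, nextVol_eq_first_coord g K hg X t ω s' θ hq]
    exact (dist_apply_le_dist_volState _ _ _).trans (ContinuousMap.dist_apply_le_dist θ)

theorem continuous_volMap (x : Fin p → ℝ) : Continuous (volMap g K hg x) := by
  refine ContinuousMap.continuous_of_continuous_uncurry _ ?_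
  have h : Continuous fun a : C(K, VolState q) × K => a.1 a.2 := continuous_eval
  exact continuous_pushState.comp (((hg x).comp (continuous_snd.prodMk h)).prodMk h)

/-- The random map `Φ_0` as a functional of the path of the observations. -/
noncomputable def pathMap (v : ℤ → ℝ) : C(K, VolState q) → C(K, VolState q) :=
  sreMap g K hg Function.eval 0 v

theorem pathMap_shiftBy (t : ℤ) (v : ℤ → ℝ) :
    pathMap hg (shiftBy t v) = sreMap g K hg Function.eval t v := by
  simp only [pathMap, sreMap, obsVec_shiftBy, zero_add]

theorem continuous_pathMap (v : ℤ → ℝ) : Continuous (pathMap hg v) := continuous_volMap hg _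

theorem volHat_succ_eq_pathMap (ς : VolState q) (n : ℕ) (v : ℤ → ℝ) :
    volHat g K hg Function.eval ς (n + 1) v =
      pathMap hg (shiftBy n v) (volHat g K hg Function.eval ς n v) := by
  rw [pathMap_shiftBy, volHat]

variable (ς : VolState q)

/-- The stationary volatility functions `(h_0, …, h_{1-q})` as a functional of the path of the
observations. -/
noncomputable def statVol (v : ℤ → ℝ) : C(K, VolState q) :=
  backwardLimit (pathMap hg) (ContinuousMap.const K ς) v

/-- The stationary squared volatility `h_0(θ)` as a functional of the path of the observations,
in the form that also makes sense for `q = 0`. -/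
noncomputable def predVol (v : ℤ → ℝ) (θ : K) : ℝ≥0 :=
  nextVol g K Function.eval (-1) v (statVol hg ς (shiftBy (-1) v)) θ

theorem predVol_shiftBy (t : ℤ) (v : ℤ → ℝ) (θ : K) :
    predVol hg ς (shiftBy (t + 1) v) θ =
      nextVol g K Function.eval t v (statVol hg ς (shiftBy t v)) θ := by
  simp only [predVol, nextVol, obsVec_shiftBy, shiftBy_shiftBy, neg_add_cancel_comm_assoc]

theorem predVol_congr_of_past {v w : ℤ → ℝ} (h : ∀ t < 0, v t = w t) (θ : K) :
    predVol hg ς v θ = predVol hg ς w θ := by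
  have hobs : ∀ t < 0, obsVec p Function.eval t v = obsVec p Function.eval t w := fun t ht =>
    funext fun i => h _ (by omega)
  have hstat : statVol hg ς (shiftBy (-1) v) = statVol hg ς (shiftBy (-1) w) := by
    refine backwardLimit_congr fun t ht => ?_
    simp only [shiftBy_shiftBy, pathMap_shiftBy, sreMap, hobs (t + -1) (by omega)]
  simp only [predVol, nextVol, hstat, hobs (-1) (by norm_num)]

theorem ae_statVol_succ {P : Measure (ℤ → ℝ)} [IsProbabilityMeasure P]
    (hP : IsContractiveOnAverage P (pathMap hg)) {s : C(K, VolState q)}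
    (hinit : meanLogPos P (fun v => edist (pathMap hg v (ContinuousMap.const K ς)) s) < ∞) :
    ∀ᵐ v ∂P, ∀ t, statVol hg ς (shiftBy (t + 1) v) =
      pathMap hg (shiftBy t v) (statVol hg ς (shiftBy t v)) := by
  have : BorelSpace C(K, VolState q) := ⟨rfl⟩
  exact hP.ae_backwardLimit_succ hinit

theorem ae_summable_mul_dist_statVol_volHat {P : Measure (ℤ → ℝ)} [IsProbabilityMeasure P]
    (hP : IsContractiveOnAverage P (pathMap hg)) {s : C(K, VolState q)}
    (hinit : meanLogPos P (fun v => edist (pathMap hg v (ContinuousMap.const K ς)) s) < ∞)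
    (hobs : Integrable (fun v : ℤ → ℝ => Real.log (1 + v 0 ^ 2)) P) :
    ∀ᵐ v ∂P, Summable fun n : ℕ => (1 + v (n + 1) ^ 2) *
      dist (statVol hg ς (shiftBy (n + 1) v)) (volHat g K hg Function.eval ς (n + 1) v) := by
  have : BorelSpace C(K, VolState q) := ⟨rfl⟩
  filter_upwards [hP.ae_dist_le_pow, ae_statVol_succ hg ς hP hinit,
    ae_isLittleO_shiftBy hP.ergodic (((measurable_pi_apply 0).pow_const 2).const_add 1).log hobs]
    with v hdist hstat hlog
  obtain ⟨ρ, hρ, hle⟩ := hdist (fun n => statVol hg ς (shiftBy n v))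
    (fun n => volHat g K hg Function.eval ς n v)
    (fun n => by exact_mod_cast hstat n) (fun n => volHat_succ_eq_pathMap hg ς n v)
  set D := dist (statVol hg ς (shiftBy (0 : ℕ) v)) (volHat g K hg Function.eval ς 0 v)
  refine .of_norm_bounded_eventually_nat
    ((summable_exp_mul_pow (hlog 1) hρ).mul_right (ρ * D)) ?_
  filter_upwards [(tendsto_add_atTop_nat 1).eventually hle] with n hn
  have hpos : 0 < 1 + v (n + 1) ^ 2 := by positivity
  push_cast at hn
  rw [Real.norm_of_nonneg (by positivity), shiftBy_apply, zero_add, Real.exp_log hpos]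
  calc _ ≤ (1 + v (n + 1) ^ 2) * (ρ ^ (n + 1) * D) := by gcongr
    _ = _ := by ring

variable (hmeas : ∀ (θ : K) (s : VolState q), Measurable fun x => g θ x s)
include hmeas

theorem measurable_pathMap (s : C(K, VolState q)) : Measurable fun v => pathMap hg v s :=
  measurable_continuousMap_of_eval fun θ => continuous_pushState.measurable.comp <|
    ((hmeas θ (s θ)).comp (measurable_obsVec_eval 0)).prodMk measurable_const

theorem measurable_statVol : Measurable (statVol hg ς) := by
  have : BorelSpace C(K, VolState q) := ⟨rfl⟩
  exact measurable_backwardLimit (continuous_pathMap hg) (measurable_pathMap hg hmeas) _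

theorem measurable_predVol (θ : K) : Measurable fun v => predVol hg ς v θ := by
  have : BorelSpace C(K, VolState q) := ⟨rfl⟩
  have huncurry : Measurable (Function.uncurry fun (s : VolState q) x => g θ x s) :=
    measurable_uncurry_of_continuous_of_measurable
      (fun x => (hg x).comp (continuous_const.prodMk continuous_id)) (hmeas θ)
  have heval : Measurable fun s : C(K, VolState q) => s θ := (continuous_eval_const θ).measurable
  exact huncurry.comp ((heval.comp ((measurable_statVol hg ς hmeas).comp
    (measurable_shiftBy (-1)))).prodMk (measurable_obsVec_eval (-1)))

end Model

/-! ### The Gaussian contrast -/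

/-- The Gaussian loss `a / y + log y` of predicting the variance `y` when the squared observation is
`a`. -/
noncomputable def gaussianLoss (a y : ℝ) : ℝ := a / y + Real.log y

theorem abs_gaussianLoss_sub_le {a c x y : ℝ} (ha : 0 ≤ a) (hc : 0 < c) (hx : c ≤ x)
    (hy : c ≤ y) :
    |gaussianLoss a x - gaussianLoss a y| ≤ (1 / c ^ 2 + 1 / c) * ((1 + a) * |x - y|) := by
  have log_sub_le : ∀ {x y : ℝ}, c ≤ x → c ≤ y → Real.log x - Real.log y ≤ 1 / c * |x - y| := by
    intro x y hx hy
    have hx0 := hc.trans_le hx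
    have hy0 := hc.trans_le hy
    calc Real.log x - Real.log y = Real.log (x / y) := (Real.log_div hx0.ne' hy0.ne').symm
      _ ≤ x / y - 1 := Real.log_le_sub_one_of_pos (by positivity)
      _ = 1 / y * (x - y) := by field_simp
      _ ≤ 1 / y * |x - y| := by
        gcongr
        exact le_abs_self _
      _ ≤ 1 / c * |x - y| := by gcongr
  have hlog : |Real.log x - Real.log y| ≤ 1 / c * |x - y| :=
    abs_sub_le_iff.2 ⟨log_sub_le hx hy, abs_sub_comm x y ▸ log_sub_le hy hx⟩
  have hx0 := hc.trans_le hx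
  have hy0 := hc.trans_le hy
  have hdiv : |a / x - a / y| ≤ a / c ^ 2 * |x - y| := by
    have hxy : a / x - a / y = a / (x * y) * (y - x) := by field_simp
    rw [hxy, abs_mul, abs_of_nonneg (by positivity), abs_sub_comm, sq]
    gcongr
  calc |gaussianLoss a x - gaussianLoss a y|
      = |(a / x - a / y) + (Real.log x - Real.log y)| := by
        rw [gaussianLoss, gaussianLoss, add_sub_add_comm]
    _ ≤ a / c ^ 2 * |x - y| + 1 / c * |x - y| := (abs_add_le _ _).trans (add_le_add hdiv hlog)
    _ ≤ (a / c ^ 2 + 1 / c) * |x - y| + (1 / c ^ 2 + a / c) * |x - y| := by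
        rw [← add_mul]
        exact le_add_of_nonneg_right (by positivity)
    _ = (1 / c ^ 2 + 1 / c) * ((1 + a) * |x - y|) := by ring

theorem log_le_gaussianLoss {a c y : ℝ} (ha : 0 ≤ a) (hc : 0 < c) (hy : c ≤ y) :
    Real.log c ≤ gaussianLoss a y :=
  (Real.log_le_log hc hy).trans (le_add_of_nonneg_left (div_nonneg ha (hc.le.trans hy)))

theorem log_one_add_le_gaussianLoss {a c y : ℝ} (ha : 0 ≤ a) (hc : 0 < c) (hy : c ≤ y) :
    Real.log (1 + a) ≤ gaussianLoss a y + 1 / c := by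
  have hy0 := hc.trans_le hy
  have hpos : 0 < (1 + a) / y := by positivity
  calc Real.log (1 + a) = Real.log ((1 + a) / y) + Real.log y := by
        rw [← Real.log_mul hpos.ne' hy0.ne', div_mul_cancel₀ _ hy0.ne']
    _ ≤ (1 + a) / y + Real.log y := by
        gcongr
        exact Real.log_le_self hpos.le
    _ = gaussianLoss a y + 1 / y := by rw [gaussianLoss]; ring
    _ ≤ gaussianLoss a y + 1 / c := by gcongr

theorem gaussianLoss_self {s : ℝ} (hs : s ≠ 0) : gaussianLoss s s = 1 + Real.log s := by
  rw [gaussianLoss, div_self hs]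

theorem gaussianLoss_self_lt {s y : ℝ} (hs : 0 < s) (hy : 0 < y) (hne : y ≠ s) :
    gaussianLoss s s < gaussianLoss s y := by
  have h := Real.log_lt_sub_one_of_pos (div_pos hs hy)
    fun h => hne ((div_eq_one_iff_eq hy.ne').1 h).symm
  rw [Real.log_div hs.ne' hy.ne'] at h
  rw [gaussianLoss_self hs.ne', gaussianLoss]
  linarith

section Contrast

variable {d p q : ℕ} {Θ : Set (EuclideanSpace ℝ (Fin d))}
  {g : Θ → (Fin p → ℝ) → VolState q → ℝ≥0} {K : Compacts Θ}
  (hg : ∀ x, Continuous fun a : K × VolState q => g a.1 x a.2) (ς : VolState q) (c : ℝ≥0)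

/-- The stationary contrast `X_0² / h_0(θ) + log h_0(θ)` as a functional of the path of the
observations. Subtracting `log c`, where `c` is a lower bound of the volatilities, makes it
nonnegative. -/
noncomputable def contrast (v : ℤ → ℝ) (θ : K) : ℝ :=
  gaussianLoss (v 0 ^ 2) (predVol hg ς v θ) - Real.log c

variable {c}

theorem measurable_contrast (hmeas : ∀ (θ : K) (s : VolState q), Measurable fun x => g θ x s)
    (θ : K) : Measurable fun v => contrast hg ς c v θ := by
  have h := (measurable_predVol hg ς hmeas θ).coe_nnreal_real
  have hobs : Measurable fun v : ℤ → ℝ => v 0 := measurable_pi_apply 0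
  exact (((hobs.pow_const 2).div h).add h.log).sub_const _

variable (hc : 0 < c) (hlow : ∀ (θ : K) x s, c ≤ g θ x s)
include hc hlow

theorem continuous_contrast (v : ℤ → ℝ) : Continuous (contrast hg ς c v) := by
  have h : Continuous fun θ => (predVol hg ς v θ : ℝ) :=
    NNReal.continuous_coe.comp (continuous_nextVol hg _ _ _ _)
  have h0 : ∀ θ, (predVol hg ς v θ : ℝ) ≠ 0 := fun θ =>
    NNReal.coe_ne_zero.2 (hc.trans_le (hlow _ _ _)).ne'
  exact ((continuous_const.div h h0).add (h.log h0)).sub continuous_const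

theorem contrast_nonneg (v : ℤ → ℝ) (θ : K) : 0 ≤ contrast hg ς c v θ :=
  sub_nonneg.2 (log_le_gaussianLoss (sq_nonneg _) hc (hlow _ _ _))

theorem integrable_log_one_add_sq_of_contrast {P : Measure (ℤ → ℝ)} [IsFiniteMeasure P] {θ : K}
    (hi : Integrable (fun v => contrast hg ς c v θ) P) :
    Integrable (fun v => Real.log (1 + v 0 ^ 2)) P := by
  refine (hi.add (integrable_const (Real.log c + 1 / c))).mono'
    (((measurable_pi_apply 0).pow_const 2).const_add 1).log.aestronglyMeasurable
    (ae_of_all _ fun v => ?_)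
  rw [Real.norm_of_nonneg (Real.log_nonneg (le_add_of_nonneg_right (sq_nonneg _)))]
  have hle : (c : ℝ) ≤ predVol hg ς v θ := NNReal.coe_le_coe.2 (hlow _ _ _)
  have h := log_one_add_le_gaussianLoss (sq_nonneg (v 0)) (NNReal.coe_pos.2 hc) hle
  simp only [Pi.add_apply, contrast]
  linarith

variable {P : Measure (ℤ → ℝ)} [IsProbabilityMeasure P]
  (hP : IsContractiveOnAverage P (pathMap hg)) {s : C(K, VolState q)}
  (hinit : meanLogPos P (fun v => edist (pathMap hg v (ContinuousMap.const K ς)) s) < ∞)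
  (hobs : Integrable (fun v : ℤ → ℝ => Real.log (1 + v 0 ^ 2)) P)
include hP hinit hobs

theorem ae_exists_abs_quasiLogLik_add_le :
    ∀ᵐ v ∂P, ∃ C : ℝ, ∀ (n : ℕ) (θ : K), |2 * quasiLogLik g K hg Function.eval ς n v θ +
      ∑ t ∈ Finset.range n, contrast hg ς c (shiftBy (t + 1) v) θ + n * Real.log c| ≤ C := by
  filter_upwards [ae_summable_mul_dist_statVol_volHat hg ς hP hinit hobs,
    ae_statVol_succ hg ς hP hinit] with v hsum hstat
  set u : ℕ → ℝ := fun n => (1 / (c : ℝ) ^ 2 + 1 / c) * ((1 + v (n + 1) ^ 2) *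
    dist (statVol hg ς (shiftBy (n + 1) v)) (volHat g K hg Function.eval ς (n + 1) v))
  let hhat (t : ℕ) (θ : K) : ℝ :=
    nextVol g K Function.eval t v (volHat g K hg Function.eval ς t v) θ
  have hterm : ∀ (t : ℕ) (θ : K), |gaussianLoss (v (t + 1) ^ 2)
      (predVol hg ς (shiftBy (t + 1) v) θ) - gaussianLoss (v (t + 1) ^ 2) (hhat t θ)| ≤ u t := by
    intro t θ
    have hvol : |(predVol hg ς (shiftBy (t + 1) v) θ : ℝ) - hhat t θ| ≤
        dist (statVol hg ς (shiftBy (t + 1) v)) (volHat g K hg Function.eval ς (t + 1) v) := by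
      rw [predVol_shiftBy, hstat, volHat_succ_eq_pathMap, pathMap_shiftBy]
      exact abs_nextVol_sub_le hg _ _ _ _ _ θ
    calc _ ≤ (1 / (c : ℝ) ^ 2 + 1 / c) * ((1 + v (t + 1) ^ 2) *
          |(predVol hg ς (shiftBy (t + 1) v) θ : ℝ) - hhat t θ|) :=
        abs_gaussianLoss_sub_le (sq_nonneg _) (NNReal.coe_pos.2 hc)
          (NNReal.coe_le_coe.2 (hlow _ _ _)) (NNReal.coe_le_coe.2 (hlow _ _ _))
      _ ≤ u t := mul_le_mul_of_nonneg_left (mul_le_mul_of_nonneg_left hvol (by positivity))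
          (by positivity)
  refine ⟨∑' n, u n, fun n θ => ?_⟩
  calc _ = |∑ t ∈ Finset.range n, (gaussianLoss (v (t + 1) ^ 2)
        (predVol hg ς (shiftBy (t + 1) v) θ) - gaussianLoss (v (t + 1) ^ 2) (hhat t θ))| := by
        simp only [quasiLogLik, contrast, gaussianLoss, hhat, Function.eval, shiftBy_apply,
          zero_add, Finset.sum_sub_distrib, Finset.sum_const, Finset.card_range, nsmul_eq_mul]
        ring_nf
    _ ≤ ∑ t ∈ Finset.range n, u t :=
        (Finset.abs_sum_le_sum_abs _ _).trans (Finset.sum_le_sum fun t _ => hterm t θ)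
    _ ≤ ∑' n, u n := (hsum.mul_left _).sum_le_tsum _ fun t _ => by positivity

end Contrast

/-! ### Transfer to the path space -/

section Transfer

variable {Ω : Type*} [MeasurableSpace Ω] {μ : Measure Ω}

theorem meanLogPos_map {S : Type*} [MeasurableSpace S] {f : Ω → S} {Y : S → ℝ≥0∞}
    (hf : Measurable f) (hY : Measurable Y) :
    meanLogPos (μ.map f) Y = meanLogPos μ fun ω => Y (f ω) :=
  lintegral_map (measurable_ereal_toENNReal.comp (ENNReal.measurable_log.comp hY)) hf

theorem meanLogNeg_map {S : Type*} [MeasurableSpace S] {f : Ω → S} {Y : S → ℝ≥0∞}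
    (hf : Measurable f) (hY : Measurable Y) :
    meanLogNeg (μ.map f) Y = meanLogNeg μ fun ω => Y (f ω) :=
  lintegral_map (measurable_ereal_toENNReal.comp (ENNReal.measurable_log.comp hY).neg) hf

theorem meanLogNegative_map_iff {S : Type*} [MeasurableSpace S] {f : Ω → S} {Y : S → ℝ≥0∞}
    (hf : Measurable f) (hY : Measurable Y) :
    MeanLogNegative (μ.map f) Y ↔ MeanLogNegative μ fun ω => Y (f ω) := by
  rw [MeanLogNegative, MeanLogNegative, meanLogPos_map hf hY, meanLogNeg_map hf hY]

section Factor

variable {E E' : Type*}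

theorem semiconj_comp_shiftBy (H : (ℤ → E) → E') :
    Function.Semiconj (fun (w : ℤ → E) (t : ℤ) => H (shiftBy t w)) seqShift seqShift := by
  intro w
  funext t
  simp [seqShift_eq_shiftBy]

variable [MeasurableSpace E] [MeasurableSpace E'] {v : ℤ → Ω → E}

theorem measurePreserving_comp_shiftBy (hv : ∀ t, Measurable (v t)) {H : (ℤ → E) → E'}
    (hH : Measurable H) : MeasurePreserving (fun w t => H (shiftBy t w)) (seqLaw μ v)
      (seqLaw μ fun t ω => H (shiftBy t (v · ω))) := by
  have hG : Measurable fun (w : ℤ → E) (t : ℤ) => H (shiftBy t w) :=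
    measurable_pi_lambda _ fun t => hH.comp (measurable_shiftBy t)
  exact ⟨hG, Measure.map_map hG (measurable_pi_lambda _ hv)⟩

theorem IsStationarySeq.comp_shiftBy (hv : IsStationarySeq μ v) {H : (ℤ → E) → E'}
    (hH : Measurable H) : IsStationarySeq μ fun t ω => H (shiftBy t (v · ω)) :=
  ⟨fun t => hH.comp ((measurable_shiftBy t).comp (measurable_pi_lambda _ hv.1)),
    (measurePreserving_comp_shiftBy hv.1 hH).of_semiconj hv.2 (semiconj_comp_shiftBy H)
      (measurable_shiftBy 1)⟩

theorem IsStationaryErgodicSeq.comp_shiftBy (hv : IsStationaryErgodicSeq μ v)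
    {H : (ℤ → E) → E'} (hH : Measurable H) :
    IsStationaryErgodicSeq μ fun t ω => H (shiftBy t (v · ω)) :=
  ⟨fun t => hH.comp ((measurable_shiftBy t).comp (measurable_pi_lambda _ hv.1)),
    (measurePreserving_comp_shiftBy hv.1 hH).ergodic_of_ergodic_semiconj hv.2
      (measurable_shiftBy 1) (semiconj_comp_shiftBy H)⟩

end Factor

variable {d p q : ℕ} {Θ : Set (EuclideanSpace ℝ (Fin d))}
  {g : Θ → (Fin p → ℝ) → VolState q → ℝ≥0} {K : Compacts Θ} {X : ℤ → Ω → ℝ}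
  (hg : ∀ x, Continuous fun a : K × VolState q => g a.1 x a.2) (ς : VolState q)

omit [MeasurableSpace Ω] in
theorem volHat_eval (n : ℕ) (ω : Ω) :
    volHat g K hg Function.eval ς n (X · ω) = volHat g K hg X ς n ω := by
  induction n with
  | zero => rfl
  | succ n ih =>
    rw [volHat, volHat, ih]
    rfl

omit [MeasurableSpace Ω] in
theorem quasiLogLik_eval (n : ℕ) (ω : Ω) (θ : K) :
    quasiLogLik g K hg Function.eval ς n (X · ω) θ = quasiLogLik g K hg X ς n ω θ := by
  simp only [quasiLogLik, volHat_eval]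
  rfl

theorem isContractiveOnAverage_pathMap (hX : IsStationaryErgodicSeq μ X)
    (hmeas : ∀ (θ : K) (s : VolState q), Measurable fun x => g θ x s)
    (hlip : meanLogPos μ (fun ω => lipCoeff (sreMap g K hg X 0 ω)) < ∞)
    (hcontr : ∃ r : ℕ, 1 ≤ r ∧
      MeanLogNegative μ fun ω => lipCoeff (pastIterate (fun t => sreMap g K hg X t ω) 0 r)) :
    IsContractiveOnAverage (seqLaw μ X) (pathMap hg) := by
  have : BorelSpace C(K, VolState q) := ⟨rfl⟩
  have hpath : Measurable fun ω t => X t ω := measurable_pi_lambda _ hX.1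
  have hc := continuous_pathMap hg
  have hm := measurable_pathMap hg hmeas
  obtain ⟨r, hr, hcontr⟩ := hcontr
  refine ⟨hX.2, hc, hm, ?_, r, hr, ?_⟩
  · rw [seqLaw, meanLogPos_map hpath (measurable_lipCoeff hc hm)]
    exact hlip
  · have hm_r : Measurable fun v => lipCoeff (pastIterate (mapsAlong (pathMap hg) v) 0 r) :=
      measurable_lipCoeff (fun v => continuous_pastIterate (fun t => hc _) 0 r)
        (measurable_pastIterate (fun t v => hc _)
          (fun t x => (hm x).comp (measurable_shiftBy t)) 0 r)
    rw [seqLaw, meanLogNegative_map_iff hpath hm_r]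
    have hmaps (v : ℤ → ℝ) :
        mapsAlong (pathMap hg) v = fun t => sreMap g K hg Function.eval t v :=
      funext fun t => pathMap_shiftBy hg t v
    simp only [hmaps]
    exact hcontr

theorem isStationarySRESolution_statVol [IsProbabilityMeasure μ] (hX : IsStationarySeq μ X)
    (hmeas : ∀ (θ : K) (s : VolState q), Measurable fun x => g θ x s)
    (hP : IsContractiveOnAverage (seqLaw μ X) (pathMap hg)) {s : C(K, VolState q)}
    (hinit : meanLogPos (seqLaw μ X)
      (fun v => edist (pathMap hg v (ContinuousMap.const K ς)) s) < ∞) :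
    IsStationarySRESolution μ g K hg X fun t ω => statVol hg ς (shiftBy t (X · ω)) := by
  have hpath : AEMeasurable (fun ω t => X t ω) μ := (measurable_pi_lambda _ hX.1).aemeasurable
  have : IsProbabilityMeasure (seqLaw μ X) := Measure.isProbabilityMeasure_map hpath
  have hsucc := ae_statVol_succ hg ς hP hinit
  refine ⟨hX.comp_shiftBy (measurable_statVol hg ς hmeas), fun t => ?_⟩
  filter_upwards [ae_of_ae_map hpath hsucc] with ω hω
  rw [hω, pathMap_shiftBy]
  rfl

end Transfer

/-! ### Innovations with unit conditional variance -/

section Noise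

variable {Ω : Type*} {mΩ : MeasurableSpace Ω} {μ : Measure Ω} [IsProbabilityMeasure μ]

theorem lintegral_mul_ofReal_of_condExp_eq_one {m : MeasurableSpace Ω} (hm : m ≤ mΩ)
    {a : Ω → ℝ≥0∞} (ha : Measurable[m] a) {z : Ω → ℝ} (hz : 0 ≤ᵐ[μ] z) (h : μ[z | m] =ᵐ[μ] 1) :
    ∫⁻ ω, a ω * ENNReal.ofReal (z ω) ∂μ = ∫⁻ ω, a ω ∂μ := by
  have hi : Integrable z μ := by
    by_contra hz
    rw [condExp_of_not_integrable hz] at h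
    simpa using h.exists
  have hdensity : (μ.withDensity fun ω => ENNReal.ofReal (z ω)).trim hm = μ.trim hm := by
    refine @Measure.ext _ m _ _ fun s hs => ?_
    rw [trim_measurableSet_eq hm hs, trim_measurableSet_eq hm hs, withDensity_apply _ (hm s hs),
      ← ofReal_integral_eq_lintegral_ofReal hi.integrableOn (ae_restrict_of_ae hz),
      ← setIntegral_condExp hm hi hs, setIntegral_congr_ae (hm s hs) (h.mono fun _ h _ => h)]
    simp
  calc ∫⁻ ω, a ω * ENNReal.ofReal (z ω) ∂μ
      = ∫⁻ ω, a ω ∂(μ.withDensity fun ω => ENNReal.ofReal (z ω)) := by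
        rw [lintegral_withDensity_eq_lintegral_mul₀ hi.aemeasurable.ennreal_ofReal
          (ha.mono hm le_rfl).aemeasurable]
        simp only [Pi.mul_apply, mul_comm]
    _ = ∫⁻ ω, a ω ∂μ := by rw [← lintegral_trim hm ha, hdensity, lintegral_trim hm ha]

theorem lintegral_gaussianLoss_mul_sub {m : MeasurableSpace Ω} (hm : m ≤ mΩ) {s y z : Ω → ℝ}
    {c : ℝ} (hc : 0 < c) (hs : Measurable[m] s) (hs0 : ∀ ω, 0 ≤ s ω) (hy : Measurable[m] y)
    (hcy : ∀ᵐ ω ∂μ, c ≤ y ω) (hz : 0 ≤ᵐ[μ] z) (h : μ[z | m] =ᵐ[μ] 1) :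
    ∫⁻ ω, ENNReal.ofReal (gaussianLoss (s ω * z ω) (y ω) - Real.log c) ∂μ =
      ∫⁻ ω, ENNReal.ofReal (gaussianLoss (s ω) (y ω) - Real.log c) ∂μ := by
  have hb : Measurable[mΩ] fun ω => ENNReal.ofReal (Real.log (y ω) - Real.log c) :=
    ((hy.mono hm le_rfl).log.sub_const _).ennreal_ofReal
  have hsplit : ∀ {a y}, 0 ≤ a → c ≤ y → ENNReal.ofReal (gaussianLoss a y - Real.log c) =
      ENNReal.ofReal (a / y) + ENNReal.ofReal (Real.log y - Real.log c) := fun ha hy => by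
    rw [← ENNReal.ofReal_add (div_nonneg ha (hc.le.trans hy))
      (sub_nonneg.2 (Real.log_le_log hc hy)), gaussianLoss, add_sub_assoc]
  calc _ = ∫⁻ ω, (ENNReal.ofReal (s ω / y ω) * ENNReal.ofReal (z ω) +
          ENNReal.ofReal (Real.log (y ω) - Real.log c)) ∂μ := by
        refine lintegral_congr_ae ?_
        filter_upwards [hcy, hz] with ω hω hzω
        rw [hsplit (mul_nonneg (hs0 ω) hzω) hω, mul_div_right_comm,
          ENNReal.ofReal_mul (div_nonneg (hs0 ω) (hc.le.trans hω))]
    _ = ∫⁻ ω, (ENNReal.ofReal (s ω / y ω) +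
          ENNReal.ofReal (Real.log (y ω) - Real.log c)) ∂μ := by
        rw [lintegral_add_right _ hb, lintegral_add_right _ hb]
        exact congrArg (· + _)
          (lintegral_mul_ofReal_of_condExp_eq_one hm (hs.div hy).ennreal_ofReal hz h)
    _ = _ := lintegral_congr_ae (hcy.mono fun ω hω => (hsplit (hs0 ω) hω).symm)

variable {Z : ℤ → Ω → ℝ}

omit mΩ in
theorem pastField_mono {s t : ℤ} (h : s ≤ t) : pastField Z s ≤ pastField Z t :=
  iSup₂_le fun k hk => le_iSup₂_of_le k (hk.trans h) le_rfl

omit mΩ in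
theorem measurable_pastField (t : ℤ) : Measurable[pastField Z t] (Z t) :=
  Measurable.of_comap_le (le_iSup₂_of_le t le_rfl le_rfl)

theorem pastField_le (hZ : ∀ t, Measurable (Z t)) (t : ℤ) : pastField Z t ≤ mΩ :=
  iSup₂_le fun k _ => (hZ k).comap_le

theorem IsIIDNoise.condExp_sq_eq_one (hZ : IsIIDNoise μ Z) :
    μ[fun ω => Z 0 ω ^ 2 | pastField Z (-1)] =ᵐ[μ] 1 := by
  have hindep : Indep (MeasurableSpace.comap (Z 0) inferInstance) (pastField Z (-1)) μ := by
    simpa using indep_iSup_of_disjoint (fun k => (hZ.measurable k).comap_le) hZ.indep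
      (S := {0}) (T := {k | k ≤ -1}) (by simp)
  filter_upwards [condExp_indep_eq (hZ.measurable 0).comap_le (pastField_le hZ.measurable (-1))
    ((comap_measurable (Z 0)).pow_const 2).stronglyMeasurable hindep] with ω hω
  exact hω.trans hZ.second_moment

end Noise

/-! ### The expected contrast -/

section Expectation

variable {Ω : Type*} [MeasurableSpace Ω] {μ : Measure Ω}
  {d p q : ℕ} {Θ : Set (EuclideanSpace ℝ (Fin d))}
  {g : Θ → (Fin p → ℝ) → VolState q → ℝ≥0} {K : Compacts Θ}
  {Z : ℤ → Ω → ℝ} {X : ℤ → Ω → ℝ} {σ : ℤ → Ω → ℝ≥0} {γ : (Fin p → ℝ) → VolState q → ℝ≥0}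
  (hsol : IsModelSolution μ Z γ X σ)
  (hmeas : ∀ (θ : K) (s : VolState q), Measurable fun x => g θ x s)
  (hg : ∀ x, Continuous fun a : K × VolState q => g a.1 x a.2) (ς : VolState q)
include hsol hmeas

theorem exists_measurable_pastField_predVol_ae_eq (θ : K) :
    ∃ h : Ω → ℝ≥0, Measurable[pastField Z (-1)] h ∧
      ∀ᵐ ω ∂μ, predVol hg ς (X · ω) θ = h ω := by
  let w : Ω → ℤ → ℝ := fun ω t => if t < 0 then σ t ω * Z t ω else 0
  have hw : Measurable[pastField Z (-1)] w := by
    refine @measurable_pi_lambda _ _ _ (pastField Z (-1)) _ _ fun t => ?_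
    by_cases ht : t < 0
    · have hσ : Measurable[pastField Z (-1)] (σ t) :=
        (hsol.measurable_vol t).mono (pastField_mono (by omega)) le_rfl
      have hZ : Measurable[pastField Z (-1)] (Z t) :=
        (measurable_pastField t).mono (pastField_mono (by omega)) le_rfl
      simp only [w, ht, if_true]
      exact hσ.coe_nnreal_real.mul hZ
    · simpa only [w, ht, if_false] using measurable_const
  refine ⟨fun ω => predVol hg ς (w ω) θ, (measurable_predVol hg ς hmeas θ).comp hw, ?_⟩
  filter_upwards [ae_all_iff.2 hsol.obs_eq] with ω hω
  exact predVol_congr_of_past hg ς (fun t ht => by simp [w, ht, hω t]) θ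

variable [IsProbabilityMeasure μ] {c : ℝ≥0} (hc : 0 < c) (hlow : ∀ (θ : K) x s, c ≤ g θ x s)
  (hZ : ∀ t, Measurable (Z t))
  (hvar : μ[fun ω => Z 0 ω ^ 2 | pastField Z (-1)] =ᵐ[μ] 1)
include hc hlow hZ hvar

theorem lintegral_contrast (θ : K) :
    ∫⁻ v, ENNReal.ofReal (contrast hg ς c v θ) ∂(seqLaw μ X) =
      ∫⁻ ω, ENNReal.ofReal
        (gaussianLoss (σ 0 ω ^ 2) (predVol hg ς (X · ω) θ) - Real.log c) ∂μ := by
  obtain ⟨h, hm, hh⟩ := exists_measurable_pastField_predVol_ae_eq hsol hmeas hg ς θ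
  have hσ : Measurable[pastField Z (-1)] (σ 0) := by simpa using hsol.measurable_vol 0
  have hge : ∀ᵐ ω ∂μ, (c : ℝ) ≤ h ω :=
    hh.mono fun ω hω => hω ▸ NNReal.coe_le_coe.2 (hlow _ _ _)
  calc ∫⁻ v, ENNReal.ofReal (contrast hg ς c v θ) ∂(seqLaw μ X)
      = ∫⁻ ω, ENNReal.ofReal (contrast hg ς c (X · ω) θ) ∂μ :=
        lintegral_map (measurable_contrast hg ς hmeas θ).ennreal_ofReal
          (measurable_pi_lambda _ hsol.measurable_obs)
    _ = ∫⁻ ω, ENNReal.ofReal (gaussianLoss (σ 0 ω ^ 2 * Z 0 ω ^ 2) (h ω) - Real.log c) ∂μ := by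
        refine lintegral_congr_ae ?_
        filter_upwards [hh, hsol.obs_eq 0] with ω hω hX
        rw [contrast, hω, hX, mul_pow]
    _ = ∫⁻ ω, ENNReal.ofReal (gaussianLoss (σ 0 ω ^ 2) (h ω) - Real.log c) ∂μ :=
        lintegral_gaussianLoss_mul_sub (pastField_le hZ _) (NNReal.coe_pos.2 hc)
          (hσ.coe_nnreal_real.pow_const 2) (fun ω => sq_nonneg _) hm.coe_nnreal_real hge
          (ae_of_all _ fun ω => sq_nonneg _) hvar
    _ = _ := lintegral_congr_ae (hh.mono fun ω hω => by rw [hω])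

variable {θ₀ : K} (htrue : ∀ᵐ ω ∂μ, predVol hg ς (X · ω) θ₀ = σ 0 ω ^ 2)
include htrue

theorem integrable_contrast_self
    (hlog : meanLogPos μ (fun ω => ((σ 0 ω ^ 2 : ℝ≥0) : ℝ≥0∞)) < ∞) :
    Integrable (fun v => contrast hg ς c v θ₀) (seqLaw μ X) := by
  refine ⟨(measurable_contrast hg ς hmeas θ₀).aestronglyMeasurable,
    (hasFiniteIntegral_iff_ofReal (ae_of_all _ fun v => contrast_nonneg hg ς hc hlow v θ₀)).2 ?_⟩
  rw [lintegral_contrast hsol hmeas hg ς hc hlow hZ hvar]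
  have hσ : Measurable fun ω => ((σ 0 ω ^ 2 : ℝ≥0) : ℝ≥0∞) :=
    (((hsol.measurable_vol 0).mono (pastField_le hZ _) le_rfl).pow_const 2).coe_nnreal_ennreal
  have hint : Integrable (fun ω => Real.posLog ((σ 0 ω ^ 2 : ℝ≥0) : ℝ) + (1 - Real.log c)) μ :=
    (integrable_posLog_of_meanLogPos hσ hlog).add (integrable_const _)
  refine lt_of_le_of_lt (lintegral_mono_ae ?_) hint.lintegral_lt_top
  filter_upwards [htrue] with ω hω
  have hpos : 0 < σ 0 ω ^ 2 := hω ▸ hc.trans_le (hlow _ _ _)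
  refine ENNReal.ofReal_le_ofReal ?_
  rw [hω, ← NNReal.coe_pow, gaussianLoss_self (NNReal.coe_ne_zero.2 hpos.ne')]
  have hle : Real.log ((σ 0 ω ^ 2 : ℝ≥0) : ℝ) ≤ Real.posLog ((σ 0 ω ^ 2 : ℝ≥0) : ℝ) :=
    le_max_right _ _
  linarith

theorem lintegral_contrast_lt
    (hi : Integrable (fun v => contrast hg ς c v θ₀) (seqLaw μ X)) {θ : K}
    (hne : ¬ ∀ᵐ ω ∂μ, predVol hg ς (X · ω) θ = σ 0 ω ^ 2) :
    ∫⁻ v, ENNReal.ofReal (contrast hg ς c v θ₀) ∂(seqLaw μ X) <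
      ∫⁻ v, ENNReal.ofReal (contrast hg ς c v θ) ∂(seqLaw μ X) := by
  have hfin := hi.lintegral_lt_top.ne
  simp only [lintegral_contrast hsol hmeas hg ς hc hlow hZ hvar] at hfin ⊢
  have hσ : Measurable (σ 0) := (hsol.measurable_vol 0).mono (pastField_le hZ _) le_rfl
  have hpred : Measurable fun ω => (predVol hg ς (X · ω) θ : ℝ) :=
    ((measurable_predVol hg ς hmeas θ).comp
      (measurable_pi_lambda _ hsol.measurable_obs)).coe_nnreal_real
  have hlt : ∀ᵐ ω ∂μ, predVol hg ς (X · ω) θ ≠ σ 0 ω ^ 2 →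
      ENNReal.ofReal (gaussianLoss (σ 0 ω ^ 2) (predVol hg ς (X · ω) θ₀) - Real.log c) <
        ENNReal.ofReal (gaussianLoss (σ 0 ω ^ 2) (predVol hg ς (X · ω) θ) - Real.log c) := by
    filter_upwards [htrue] with ω hω hne
    have hσc : c ≤ σ 0 ω ^ 2 := hω ▸ hlow _ _ _
    have hy : 0 < predVol hg ς (X · ω) θ := hc.trans_le (hlow _ _ _)
    have hle : Real.log c ≤ gaussianLoss ((σ 0 ω ^ 2 : ℝ≥0) : ℝ) ((σ 0 ω ^ 2 : ℝ≥0) : ℝ) :=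
      log_le_gaussianLoss (NNReal.coe_nonneg _) hc hσc
    rw [hω, ← NNReal.coe_pow, ENNReal.ofReal_lt_ofReal_iff_of_nonneg (sub_nonneg.2 hle),
      sub_lt_sub_iff_right]
    exact gaussianLoss_self_lt (NNReal.coe_pos.2 (hc.trans_le hσc)) (NNReal.coe_pos.2 hy)
      (NNReal.coe_injective.ne hne)
  refine lintegral_strict_mono_of_ae_le_of_frequently_ae_lt
    ((((hσ.coe_nnreal_real.pow_const 2).div hpred).add hpred.log).sub_const
      _).ennreal_ofReal.aemeasurable hfin ?_ ?_
  · filter_upwards [hlt, htrue] with ω hω hω₀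
    rcases eq_or_ne (predVol hg ς (X · ω) θ) (σ 0 ω ^ 2) with heq | hne
    · rw [heq, hω₀]
    · exact (hω hne).le
  · exact (not_eventually.1 hne).mp (hlt.mono fun ω h hω => (h hω).ne)

end Expectation

/-! ### Consistency -/

section Consistency

variable {d p q : ℕ} {Θ : Set (EuclideanSpace ℝ (Fin d))}
  {g : Θ → (Fin p → ℝ) → VolState q → ℝ≥0} {K : Compacts Θ}

theorem ae_forall_tendsto_of_quasiLogLik_le
    (hg : ∀ x, Continuous fun a : K × VolState q => g a.1 x a.2) (ς : VolState q)
    (hmeas : ∀ (θ : K) (s : VolState q), Measurable fun x => g θ x s)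
    {c : ℝ≥0} (hc : 0 < c) (hlow : ∀ (θ : K) x s, c ≤ g θ x s)
    {P : Measure (ℤ → ℝ)} [IsProbabilityMeasure P] (hP : IsContractiveOnAverage P (pathMap hg))
    {s : C(K, VolState q)}
    (hinit : meanLogPos P (fun v => edist (pathMap hg v (ContinuousMap.const K ς)) s) < ∞)
    {θ₀ : K} (hi : Integrable (fun v => contrast hg ς c v θ₀) P)
    (hlt : ∀ θ ≠ θ₀, ∫⁻ v, ENNReal.ofReal (contrast hg ς c v θ₀) ∂P <
      ∫⁻ v, ENNReal.ofReal (contrast hg ς c v θ) ∂P) :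
    ∀ᵐ v ∂P, ∀ (θhat : ℕ → K) (e : ℕ → ℝ), e =o[atTop] (fun n : ℕ => (n : ℝ)) →
      (∀ᶠ n in atTop, quasiLogLik g K hg Function.eval ς n v θ₀ ≤
        quasiLogLik g K hg Function.eval ς n v (θhat n) + e n) →
      Tendsto θhat atTop (𝓝 θ₀) := by
  have hobs := integrable_log_one_add_sq_of_contrast hg ς hc hlow hi
  have hmin := hP.ergodic.quasiMeasurePreserving.ae <|
    ae_forall_tendsto_of_near_minimizer hP.ergodic (continuous_contrast hg ς hc hlow)
      (measurable_contrast hg ς hmeas) (contrast_nonneg hg ς hc hlow) hi hlt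
  filter_upwards [hmin, ae_exists_abs_quasiLogLik_add_le hg ς hc hlow hP hinit hobs]
    with v hv ⟨C, hC⟩ θhat e he hnear
  have hsum (n : ℕ) (θ : K) : birkhoffSum seqShift (contrast hg ς c · θ) n (seqShift v) =
      ∑ t ∈ Finset.range n, contrast hg ς c (shiftBy (t + 1) v) θ := by
    simp only [birkhoffSum, seqShift_eq_shiftBy, iterate_shiftBy, shiftBy_shiftBy, mul_one]
  have hconst : (fun _ : ℕ => 2 * C) =o[atTop] fun n : ℕ => (n : ℝ) :=
    Asymptotics.isLittleO_const_left.2 (Or.inr (tendsto_norm_atTop_atTop.comp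
      tendsto_natCast_atTop_atTop))
  refine hv θhat (fun n => 2 * C + 2 * e n) (hconst.add (he.const_mul_left 2))
    (hnear.mono fun n hn => ?_)
  rw [hsum, hsum]
  linarith [(abs_le.1 (hC n (θhat n))).2, (abs_le.1 (hC n θ₀)).1]

/-- Approximate quasi maximum likelihood estimators: `θ̂_n` maximizes `L̂_n` over `K` up to an error
`o(n)`, almost surely. -/
def IsNearQMLE {Ω : Type*} [MeasurableSpace Ω] (μ : Measure Ω)
    (g : Θ → (Fin p → ℝ) → VolState q → ℝ≥0) (K : Compacts Θ)
    (hg : ∀ x, Continuous fun a : K × VolState q => g a.1 x a.2)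
    (X : ℤ → Ω → ℝ) (ς : VolState q) (θhat : ℕ → Ω → K) : Prop :=
  ∀ᵐ ω ∂μ, ∃ e : ℕ → ℝ, e =o[atTop] (fun n : ℕ => (n : ℝ)) ∧ ∀ᶠ n in atTop, ∀ θ : K,
    quasiLogLik g K hg X ς n ω θ ≤ quasiLogLik g K hg X ς n ω (θhat n ω) + e n

variable {Ω : Type*} [MeasurableSpace Ω] {μ : Measure Ω}

theorem IsQMLE.isNearQMLE {hg : ∀ x, Continuous fun a : K × VolState q => g a.1 x a.2}
    {X : ℤ → Ω → ℝ} {ς : VolState q} {θhat : ℕ → Ω → K} (h : IsQMLE μ g K hg X ς θhat) :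
    IsNearQMLE μ g K hg X ς θhat := by
  have hall := ae_all_iff.2 fun n => eventually_imp_distrib_left.2 (h n)
  filter_upwards [hall] with ω hω
  refine ⟨0, Asymptotics.isLittleO_zero _ _, ?_⟩
  filter_upwards [eventually_ge_atTop 1] with n hn θ
  simpa using hω n hn θ

theorem IsStationaryErgodicSolution.isStationaryErgodicSeq_obs {Z : ℤ → Ω → ℝ}
    {γ : (Fin p → ℝ) → VolState q → ℝ≥0} {X : ℤ → Ω → ℝ} {σ : ℤ → Ω → ℝ≥0}
    (h : IsStationaryErgodicSolution μ Z γ X σ) : IsStationaryErgodicSeq μ X := by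
  have hfst : Measurable fun w : ℤ → ℝ × ℝ≥0 => (w 0).1 := (measurable_pi_apply 0).fst
  simpa only [shiftBy_apply, zero_add] using h.2.comp_shiftBy hfst

theorem theorem4p1_general [IsProbabilityMeasure μ] {θ₀ : K}
    (hmeas : ∀ (θ : K) (s : VolState q), Measurable fun x => g θ x s)
    {Z : ℤ → Ω → ℝ} (hZ : ∀ t, Measurable (Z t))
    (hvar : μ[fun ω => Z 0 ω ^ 2 | pastField Z (-1)] =ᵐ[μ] 1)
    {X : ℤ → Ω → ℝ} {σ : ℤ → Ω → ℝ≥0} (hsol : IsModelSolution μ Z (g θ₀) X σ)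
    (hX : IsStationaryErgodicSeq μ X)
    (hlog : meanLogPos μ (fun ω => ((σ 0 ω ^ 2 : ℝ≥0) : ℝ≥0∞)) < ∞)
    (hcont : ∀ x, Continuous fun a : K × VolState q => g a.1 x a.2) (ς : VolState q)
    (hinit : meanLogPos μ (fun ω => edist (sreMap g K hcont X 0 ω (ContinuousMap.const K ς))
      (ContinuousMap.const K (WithLp.toLp 2 0))) < ∞)
    (hlip : meanLogPos μ (fun ω => lipCoeff (sreMap g K hcont X 0 ω)) < ∞)
    (hcontr : ∃ r : ℕ, 1 ≤ r ∧
      MeanLogNegative μ fun ω => lipCoeff (pastIterate (fun t => sreMap g K hcont X t ω) 0 r))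
    (hlow : ∃ c : ℝ≥0, 0 < c ∧ ∀ (θ : K) x s, c ≤ g θ x s)
    (hident : ∀ h : ℤ → Ω → C(K, VolState q), IsStationarySRESolution μ g K hcont X h →
      ∀ θ : K, (∀ᵐ ω ∂μ, nextVol g K X (-1) ω (h (-1) ω) θ = σ 0 ω ^ 2) ↔ θ = θ₀)
    {θhat : ℕ → Ω → K} (hθhat : IsNearQMLE μ g K hcont X ς θhat) :
    ∀ᵐ ω ∂μ, Tendsto (θhat · ω) atTop (𝓝 θ₀) := by
  obtain ⟨c, hc, hlow⟩ := hlow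
  have : BorelSpace C(K, VolState q) := ⟨rfl⟩
  have hpath : Measurable fun ω t => X t ω := measurable_pi_lambda _ hX.1
  have : IsProbabilityMeasure (seqLaw μ X) :=
    Measure.isProbabilityMeasure_map hpath.aemeasurable
  have hP := isContractiveOnAverage_pathMap hcont hX hmeas hlip hcontr
  have hinit' : meanLogPos (seqLaw μ X) (fun v => edist (pathMap hcont v (ContinuousMap.const K ς))
      (ContinuousMap.const K (WithLp.toLp 2 0))) < ∞ := by
    rw [seqLaw, meanLogPos_map hpath ((measurable_pathMap hcont hmeas _).edist measurable_const)]
    exact hinit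
  have htrue (θ : K) : (∀ᵐ ω ∂μ, predVol hcont ς (X · ω) θ = σ 0 ω ^ 2) ↔ θ = θ₀ :=
    hident _ (isStationarySRESolution_statVol hcont ς ⟨hX.1, hX.2.toMeasurePreserving⟩ hmeas hP
      hinit') θ
  have hint := integrable_contrast_self hsol hmeas hcont ς hc hlow hZ hvar ((htrue θ₀).2 rfl) hlog
  have hlt (θ : K) (hne : θ ≠ θ₀) := lintegral_contrast_lt hsol hmeas hcont ς hc hlow hZ hvar
    ((htrue θ₀).2 rfl) hint (mt (htrue θ).1 hne)
  have hcons := ae_forall_tendsto_of_quasiLogLik_le hcont ς hmeas hc hlow hP hinit' hint hlt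
  filter_upwards [ae_of_ae_map hpath.aemeasurable hcons, hθhat] with ω hω ⟨e, he, hnear⟩
  refine hω (θhat · ω) e he (hnear.mono fun n hn => ?_)
  simpa only [quasiLogLik_eval] using hn θ₀

end Consistency

/-- Strong consistency of the Gaussian quasi maximum likelihood estimator in the model
`X_t = σ_t Z_t`, `σ_t² = g_θ(X_{t-1}, …, X_{t-p}; σ_{t-1}², …, σ_{t-q}²)`. -/
theorem theorem4p1 {Ω : Type*} [MeasurableSpace Ω] (μ : Measure Ω) [IsProbabilityMeasure μ]
    {d p q : ℕ} (Θ : Set (EuclideanSpace ℝ (Fin d)))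
    (g : Θ → (Fin p → ℝ) → VolState q → ℝ≥0)
    (K : Compacts Θ) (θ₀ : Θ) (hθ₀ : θ₀ ∈ K)
    (hmeas : ∀ (θ : K) (s : VolState q), Measurable fun x => g θ x s)
    (Z : ℤ → Ω → ℝ) (hZ : IsIIDNoise μ Z)
    (X : ℤ → Ω → ℝ) (σ : ℤ → Ω → ℝ≥0)
    -- the model at `θ₀` has a unique stationary ergodic solution, and `E[log⁺ σ_0²] < ∞`
    (hsol : IsUniqueStationaryErgodicSolution μ Z (g θ₀) X σ)
    (hlog : meanLogPos μ (fun ω => ((σ 0 ω ^ 2 : ℝ≥0) : ℝ≥0∞)) < ∞)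
    -- `(θ, s) ↦ g_θ(x, s)` is continuous on `K × [0, ∞)^q` for every `x`
    (hcont : ∀ x, Continuous fun a : K × VolState q => g a.1 x a.2)
    -- `ς` is the initial value, and `E[log⁺ ‖Φ_0(ς)‖_K] < ∞`
    (ς : VolState q)
    (hinit : meanLogPos μ (fun ω => edist (sreMap g K hcont X 0 ω (ContinuousMap.const K ς))
      (ContinuousMap.const K (WithLp.toLp 2 0))) < ∞)
    -- `E[log⁺ Λ(Φ_0)] < ∞` and `E[log Λ(Φ_0^{(r)})] < 0` for some `r ≥ 1`
    (hlip : meanLogPos μ (fun ω => lipCoeff (sreMap g K hcont X 0 ω)) < ∞)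
    (hcontr : ∃ r : ℕ, 1 ≤ r ∧
      MeanLogNegative μ fun ω => lipCoeff (pastIterate (fun t => sreMap g K hcont X t ω) 0 r))
    -- `g` is uniformly bounded from below
    (hlow : ∃ c : ℝ≥0, 0 < c ∧ ∀ (θ : K) x s, c ≤ g θ x s)
    -- for the stationary solution `h` of the recurrence equation and `θ ∈ K`:
    -- `h_0(θ) = σ_0²` almost surely if and only if `θ = θ₀`
    (hident : ∀ h : ℤ → Ω → C(K, VolState q), IsStationarySRESolution μ g K hcont X h →
      ∀ θ : K, (∀ᵐ ω ∂μ, nextVol g K X (-1) ω (h (-1) ω) θ = σ 0 ω ^ 2) ↔ (θ : Θ) = θ₀)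
    (θhat : ℕ → Ω → K) (hθhat : IsQMLE μ g K hcont X ς θhat) :
    ∀ᵐ ω ∂μ, Tendsto (fun n => (θhat n ω : Θ)) atTop (𝓝 θ₀) := by
  have hident' h hh (θ : K) := (hident h hh θ).trans (Subtype.ext_iff (a2 := ⟨θ₀, hθ₀⟩)).symm
  refine (theorem4p1_general hmeas hZ.measurable hZ.condExp_sq_eq_one hsol.1.1
    hsol.1.isStationaryErgodicSeq_obs hlog hcont ς hinit hlip hcontr hlow hident'
    hθhat.isNearQMLE).mono fun ω hω => (continuous_subtype_val.tendsto _).comp hω
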